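/- Let $d,r,n\ge 1$ be integers, let $\mu$ be Lebesgue measure on $\mathbb{R}^d$ and let $\|\cdot\|_\infty$ be the essential supremum norm. Let $\mathcal{I}$ be a countable partition of $\mathbb{R}^d$ into bounded boxes (cartesian products of $d$ intervals) with $h_0:=\inf_{I\in\mathcal{I}}\mu(I)>0$. Let $m$ be the set of functions $\sum_{I\in\mathcal{I}}f_I\mathbf{1}_I$ in which every $f_I$ is a polynomial in $d$ variables with rational coefficients and total degree at most $r$, and only finitely many $f_I$ are nonzero. Put \[ h_m=\frac{(1-1/\sqrt2)^{d+1}}{(2r^2)^d}\,h_0. \] For $u,h>0$ let \[ a(u)=\frac{1}{2(d+1)}\Big[\frac{u^{-1}}{(2r^2)^d}\wedge 1\Big],\qquad \gamma(u)=\max\Big(a(u),\big[1-(2r^2)^{\frac{d}{d+1}}u^{\frac1{d+1}}\big]_+^2\Big), \] and let $\theta(h)=\frac{d}{d+1}\frac1{2r^2}$ if $\gamma(h/h_0)=a(h/h_0)$, and $\theta(h)=\big(\frac{h}{2r^2h_0}\big)^{1/(d+1)}$ otherwise. For each $f\in m$ choose a cell $I_*\in\mathcal{I}$ that maximizes $\|f\mathbf{1}_I\|_\infty$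 over $I\in\mathcal{I}$, let $f_*$ be the polynomial that coincides with $f$ on $I_*$, choose a point $x_*\in\overline{I_*}$ at which $|f_*|$ is maximal on $\overline{I_*}$, and let \[ C(f)=(1-\theta(h_m))\,x_*+\theta(h_m)\,\mathring{I}_* . \] Let $X_1,\dots,X_n$ be independent (not necessarily identically distributed) random vectors in $\mathbb{R}^d$ with densities $p_1^*,\dots,p_n^*\in L^\infty(\mathbb{R}^d)$ with respect to $\mu$, and let $p^*=\frac1n\sum_{i=1}^n p_i^*$. For $p,q\in m$ let $\tau(p,q)\in\{-1,1\}$ be the sign of $\int_{C(p-q)}(p-q)\,d\mu$ (either value if the integral is $0$) and let \[ T(\mathbf X,p,q)=\frac1n\sum_{i=1}^n\tau(p,q)\,\frac{\int_{C(p-q)}p\,d\mu-\mathbf 1_{C(p-q)}(X_i)}{\mu(C(p-q))+h_m}. \] Let $\delta>0$ and let $\hat p$ be a hun-estimator with tolerance $\delta$, that is, a random element of $m$ such that, almost surely, \[ \sup_{q\in m}T(\mathbf X,\hat p,q)\le\inf_{p\in m}\sup_{q\in m}T(\mathbf X,p,q)+\delta. \] Then, whatever the choices of $I_*$, $x_*$,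 $\tau$ and $\hat p$ as above, \begin{align*} \mathbb E\big[\|\hat p-p^*\|_\infty\big]\le{}& 5\inf_{p\in m}\|p-p^*\|_\infty+274(2d+1)(3r)^{2d}\frac{\log(en)}{h_0n}+2\delta\\ &+215\sqrt{2d+1}\,\min\left((3r)^d\sqrt{\|p^*\|_\infty}\sqrt{\frac{\log(en)}{h_0n}},\;(3r)^{2d}\frac{\sqrt{\log(en)}}{h_0\sqrt n}\right). \end{align*} -/

import Mathlib

open MeasureTheory ProbabilityTheory
open scoped ENNReal

/-- The space `ℝ^d` (its Lebesgue measure is `volume`). -/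
abbrev Rd (d : ℕ) : Type := Fin d → ℝ

/-- The class of boxes: cartesian products of `d` intervals of the real line
(open, closed, half-open, bounded or not). -/
def boxes (d : ℕ) : Set (Set (Rd d)) :=
  {S | ∃ J : Fin d → Set ℝ, (∀ i, (J i).OrdConnected) ∧ S = Set.univ.pi J}

/-- The infimum `h₀` of the volumes of the cells of a partition. -/
noncomputable def minCellVolume {d : ℕ} (cells : Set (Set (Rd d))) : ℝ :=
  sInf ((fun I => volume.real I) '' cells)

/-- A countable partition of `ℝ^d` into bounded boxes whose volumes are bounded away from zero.
Boxes are measurable and convex, and every `x + t • interior I` with `I` a box and `t > 0` is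
again a box, so these properties need not be required separately. -/
structure IsBoxPartition {d : ℕ} (cells : Set (Set (Rd d))) : Prop where
  countable : cells.Countable
  partition : Setoid.IsPartition cells
  subset_boxes : cells ⊆ boxes d
  bounded : ∀ I ∈ cells, Bornology.IsBounded I
  volume_pos : 0 < minCellVolume cells

/-- The model `m(r, cells)`: functions that coincide on each cell with a polynomial of total
degree at most `r` with rational coefficients, only finitely many of which are nonzero. -/
def piecewisePoly {d : ℕ} (r : ℕ) (cells : Set (Set (Rd d))) : Set (Rd d → ℝ) :=
  {f | ∃ g : Set (Rd d) → MvPolynomial (Fin d) ℚ,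
    (∀ I ∈ cells, (g I).totalDegree ≤ r) ∧
    {I | I ∈ cells ∧ g I ≠ 0}.Finite ∧
    ∀ I ∈ cells, ∀ x ∈ I, f x = MvPolynomial.aeval x (g I)}

/-- The first of the two lower bounds whose maximum is `gammaRD`. -/
noncomputable def gammaFst (r d : ℕ) (u : ℝ) : ℝ :=
  1 / (2 * ((d : ℝ) + 1)) * min (u⁻¹ / (2 * (r : ℝ) ^ 2) ^ d) 1

/-- `γ_{r,d}(u)`. -/
noncomputable def gammaRD (r d : ℕ) (u : ℝ) : ℝ :=
  max (gammaFst r d u)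
    ((max (1 - (2 * (r : ℝ) ^ 2) ^ ((d : ℝ) / ((d : ℝ) + 1)) * u ^ (1 / ((d : ℝ) + 1))) 0) ^ 2)

open Classical in
/-- The scaling factor `θ_m(h)` of the test sets. -/
noncomputable def thetaM (r d : ℕ) (h₀ h : ℝ) : ℝ :=
  if gammaRD r d (h / h₀) = gammaFst r d (h / h₀) then
    (d : ℝ) / ((d : ℝ) + 1) * (1 / (2 * (r : ℝ) ^ 2))
  else (h / (2 * (r : ℝ) ^ 2 * h₀)) ^ (1 / ((d : ℝ) + 1))

/-- `C` is a test set `C_{h,m}(f) = (1 - θ) x⋆ + θ interior I⋆` for the piecewise polynomial `f`: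
the cell `I⋆` maximizes the essential supremum of `|f|` over the cells, `g` is the polynomial that
coincides with `f` on `I⋆`, and `|g|` is maximal on the closure of `I⋆` at `x⋆`. -/
def IsTestSet {d : ℕ} (r : ℕ) (cells : Set (Set (Rd d))) (h : ℝ) (f : Rd d → ℝ)
    (C : Set (Rd d)) : Prop :=
  ∃ I ∈ cells,
    (∀ J ∈ cells, eLpNorm (J.indicator f) ∞ volume ≤ eLpNorm (I.indicator f) ∞ volume) ∧
    ∃ g : MvPolynomial (Fin d) ℝ, (∀ y ∈ I, f y = MvPolynomial.eval y g) ∧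
    ∃ x ∈ closure I, (∀ y ∈ closure I, |MvPolynomial.eval y g| ≤ |MvPolynomial.eval x g|) ∧
      C = (fun y => (1 - thetaM r d (minCellVolume cells) h) • x +
            thetaM r d (minCellVolume cells) h • y) '' interior I

/-- `s ∈ {-1, 1}` is a sign of `a` (either value is allowed if `a = 0`). -/
def IsSignOf (s a : ℝ) : Prop := (s = 1 ∨ s = -1) ∧ s * a = |a|

/-- The test statistic `T(x, p, q)` for the parameter `h`, the test sets `C p q` and the
signs `τ p q`. -/
noncomputable def tStat {d n : ℕ} (h : ℝ) (C : (Rd d → ℝ) → (Rd d → ℝ) → Set (Rd d))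
    (τ : (Rd d → ℝ) → (Rd d → ℝ) → ℝ) (x : Fin n → Rd d) (p q : Rd d → ℝ) : ℝ :=
  (1 / (n : ℝ)) * ∑ i, τ p q *
    (((∫ y in C p q, p y) - (C p q).indicator (fun _ => (1 : ℝ)) (x i)) /
      (volume.real (C p q) + h))

/-- `T_m(x, p) = sup_{q ∈ m} T(x, p, q)`. -/
noncomputable def tSup {d n : ℕ} (m : Set (Rd d → ℝ)) (h : ℝ)
    (C : (Rd d → ℝ) → (Rd d → ℝ) → Set (Rd d)) (τ : (Rd d → ℝ) → (Rd d → ℝ) → ℝ)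
    (x : Fin n → Rd d) (p : Rd d → ℝ) : EReal :=
  ⨆ q ∈ m, (tStat h C τ x p q : EReal)

/-- `phat` is an `h`-approximate uniform-norm estimator (hun-estimator) on the countable model `m`
with tolerance `δ`: a random element of `m` (with the discrete σ-algebra) that minimizes
`T_m(X, ·)` over `m` up to `δ`, almost surely. It may use randomness beyond the sample. -/
structure IsHunEstimator {Ω : Type*} [MeasurableSpace Ω] (P : Measure Ω) {d n : ℕ}
    (X : Fin n → Ω → Rd d) (m : Set (Rd d → ℝ)) (h : ℝ)
    (C : (Rd d → ℝ) → (Rd d → ℝ) → Set (Rd d)) (τ : (Rd d → ℝ) → (Rd d → ℝ) → ℝ)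
    (δ : ℝ) (phat : Ω → Rd d → ℝ) : Prop where
  mem : ∀ ω, phat ω ∈ m
  measurable : ∀ p ∈ m, MeasurableSet {ω | phat ω = p}
  sign : ∀ p ∈ m, ∀ q ∈ m, IsSignOf (τ p q) (∫ y in C p q, (p y - q y))
  le : ∀ᵐ ω ∂P, tSup m h C τ (fun i => X i ω) (phat ω) ≤
    (⨅ p ∈ m, tSup m h C τ (fun i => X i ω) p) + (δ : EReal)

/-- The choice of the parameter `h_m` for the model `m(r, cells)`. -/
noncomputable def hModel {d : ℕ} (r : ℕ) (cells : Set (Set (Rd d))) : ℝ :=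
  (1 - 1 / Real.sqrt 2) ^ (d + 1) / (2 * (r : ℝ) ^ 2) ^ d * minCellVolume cells

/-- The average `p⋆ = (1/n) ∑ p_i⋆` of `n` functions. -/
noncomputable def meanDensity {d n : ℕ} (p : Fin n → Rd d → ℝ) : Rd d → ℝ :=
  fun x => (1 / (n : ℝ)) * ∑ i, p i x

/-! The argument has a deterministic half and a probabilistic half, joined by the normalisation
`volume.real C + h` with `h = hModel`.

Test sets. A polynomial of degree at most `r` that attains its maximal modulus over a segment at one
endpoint stays above `√2/2` times that value on a stretch of relative length of order `1/r²`,
because among competitors the Chebyshev polynomial drops fastest (`sqrt_two_div_two_le_eval`).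
Shrinking the best cell towards its maximum point `x⋆` by the factor `θ` therefore gives a box on
which `f` keeps its sign and a fixed proportion of its norm. As `h` is at most a fixed fraction of
the volume of that box, `‖f‖∞ ≤ 2 |∫_C f| / (volume.real C + h)` (`IsTestSet.properties`).

Comparison. Suppose the empirical measure deviates from `p⋆` on each box `B` by at most `Z
(volume.real B + h)`. Testing `phat` against any `q` in the model and using the near-minimality of
`phat` gives `‖phat - p⋆‖ ≤ 5 ‖q - p⋆‖ + 4 Z + 2 δ` (`eLpNorm_sub_le_of_tSup_le`).

Deviations. All test sets are boxes, and boxes can be bracketed by `(n+1)^(2d)` grid boxes up to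
mass `2d/n` (`exists_box_bracketing`). Exponential moments then bound all deviations at once by `t
Q(B) + (4d + R/t)/n`, with `R` of mean at most logarithmic in `n` (`exists_box_deviation_bound`).
Since the average law satisfies `Q(B) ≤ min(‖p⋆‖, 1/h) (volume.real B + h)`, this has the required
form, and optimising `t` produces the square-root term and the linear term. -/

/-! ### Chebyshev polynomials and the decay of a polynomial near its maximum -/

open Polynomial in
/-- Among the polynomials of degree at most `n` that are bounded by `1` on `[-1, 1]` and equal to
`1` at `1`, the Chebyshev polynomial is the smallest one near `1`. -/
theorem Polynomial.Chebyshev.eval_T_le_eval {n : ℕ} {P : ℝ[X]} (hdeg : P.degree ≤ n)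
    (hbd : ∀ x ∈ Set.Icc (-1 : ℝ) 1, |P.eval x| ≤ 1) (h1 : P.eval 1 = 1) {x : ℝ}
    (hx : node n 1 ≤ x) (hx1 : x ≤ 1) : (T ℝ n).eval x ≤ P.eval x := by
  have hinj : Set.InjOn (node n ·) (Finset.range (n + 1)) := (strictAntiOn_node n).injOn
  have hdeg' : (T ℝ n - P).degree < (Finset.range (n + 1)).card := by
    refine lt_of_le_of_lt (degree_sub_le _ _) ?_
    rw [Finset.card_range, max_lt_iff]
    have hn : (n : WithBot ℕ) < ((n + 1 : ℕ) : WithBot ℕ) := by exact_mod_cast Nat.lt_succ_self n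
    exact ⟨lt_of_le_of_lt (degree_T ℝ n).le (by simpa using hn), lt_of_le_of_lt hdeg hn⟩
  -- Lagrange interpolation at the Chebyshev nodes: the term of node `0` vanishes, and for `i ≥ 1`
  -- the value of `T - P` at the node has sign `(-1)^i`, while the basis polynomial at `x` has the
  -- opposite sign, since only its factor `x - 1` is nonpositive.
  have key : (T ℝ n - P).eval x ≤ 0 := by
    rw [Lagrange.eq_interpolate hinj hdeg', Lagrange.interpolate_apply, eval_finsetSum]
    refine Finset.sum_nonpos fun i hi => ?_
    have hin : i ≤ n := by simpa [Nat.lt_succ_iff] using hi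
    rw [eval_mul, eval_C, eval_sub, eval_T_real_node (by simpa using hin)]
    rcases Nat.eq_zero_or_pos i with rfl | hi0
    · simp [node_eq_one, h1]
    have hD : 0 ≤ (-1 : ℝ) ^ i * ((-1) ^ i - P.eval (node n i)) := by
      have h2 := abs_le.1 (hbd _ (node_mem_Icc (n := n) (i := i)))
      rcases neg_one_pow_eq_or ℝ i with h | h <;> rw [h] <;> linarith
    have hB : (-1 : ℝ) ^ i * (Lagrange.basis (Finset.range (n + 1)) (node n ·) i).eval x ≤ 0 := by
      have h0mem : 0 ∈ (Finset.range (n + 1)).erase i := by simp [hi0.ne]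
      have hnum : ∏ j ∈ (Finset.range (n + 1)).erase i, (x - node n j) ≤ 0 := by
        rw [← Finset.mul_prod_erase _ _ h0mem, node_eq_one]
        refine mul_nonpos_of_nonpos_of_nonneg (by linarith) (Finset.prod_nonneg fun j hj => ?_)
        simp only [Finset.mem_erase, Finset.mem_range] at hj
        have : node n j ≤ node n 1 := by
          rcases Nat.lt_or_ge 1 j with h | h
          · exact (node_lt (by omega) h).le
          · rw [show j = 1 by omega]
        linarith
      have hden := zero_lt_prod_node_sub_node hin
      have heq : (Lagrange.basis (Finset.range (n + 1)) (node n ·) i).eval x =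
          (∏ j ∈ (Finset.range (n + 1)).erase i, (x - node n j)) *
          (∏ j ∈ (Finset.range (n + 1)).erase i, (node n i - node n j))⁻¹ := by
        simp only [Lagrange.basis, Lagrange.basisDivisor, eval_prod, eval_mul, eval_C, eval_sub,
          eval_X, Finset.prod_mul_distrib, Finset.prod_inv_distrib]
        ring
      have hsign : (-1 : ℝ) ^ i * (∏ j ∈ (Finset.range (n + 1)).erase i,
          (node n i - node n j))⁻¹ ≥ 0 := by
        rcases neg_one_pow_eq_or ℝ i with h | h <;> rw [h] at hden ⊢
        · rw [one_mul] at hden ⊢; exact (inv_pos.2 hden).le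
        · have : ∏ j ∈ (Finset.range (n + 1)).erase i, (node n i - node n j) < 0 := by linarith
          have := inv_neg''.2 this
          linarith
      rw [heq, mul_left_comm]
      exact mul_nonpos_of_nonpos_of_nonneg hnum hsign
    have hpm : ((-1 : ℝ) ^ i) * (-1) ^ i = 1 := by rw [← mul_pow]; simp
    have := mul_nonpos_of_nonneg_of_nonpos hD hB
    calc _ = ((-1 : ℝ) ^ i * (-1) ^ i) * (((-1) ^ i - P.eval (node n i)) *
          (Lagrange.basis (Finset.range (n + 1)) (node n ·) i).eval x) := by rw [hpm, one_mul]
      _ ≤ 0 := by linarith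
  rw [eval_sub] at key
  linarith

theorem abs_sin_nat_mul_le (n : ℕ) (y : ℝ) : |Real.sin (n * y)| ≤ n * |Real.sin y| := by
  induction n with
  | zero => simp
  | succ k ih =>
    push_cast
    rw [add_mul, one_mul, Real.sin_add, add_mul, one_mul]
    refine (abs_add_le _ _).trans ?_
    rw [abs_mul, abs_mul]
    have h1 := Real.abs_cos_le_one y
    have h2 := Real.abs_cos_le_one (k * y)
    have h3 := abs_nonneg (Real.sin (k * y))
    have h4 := abs_nonneg (Real.sin y)
    nlinarith

theorem one_sub_cos_nat_mul_le (n : ℕ) (y : ℝ) :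
    1 - Real.cos (n * y) ≤ n ^ 2 * (1 - Real.cos y) := by
  have h := abs_sin_nat_mul_le n (y / 2)
  have h2 : Real.sin (n * (y / 2)) ^ 2 ≤ (n * |Real.sin (y / 2)|) ^ 2 := by
    rw [← sq_abs]; gcongr
  rw [mul_pow, sq_abs] at h2
  have e1 := Real.cos_sq' (n * (y / 2))
  have e2 := Real.cos_sq' (y / 2)
  have e3 := Real.cos_two_mul (n * (y / 2))
  have e4 := Real.cos_two_mul (y / 2)
  rw [show 2 * (n * (y / 2)) = n * y by ring] at e3
  rw [show 2 * (y / 2) = y by ring] at e4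
  rw [e3, e4, e1, e2]
  nlinarith

/-- The scaling factor of the test sets for the parameter `hModel`. -/
noncomputable def modelTheta (r : ℕ) : ℝ := (1 - 1 / Real.sqrt 2) / (2 * (r : ℝ) ^ 2)

theorem one_div_sqrt_two : 1 / Real.sqrt 2 = Real.sqrt 2 / 2 := by
  rw [div_eq_div_iff (by positivity) (by positivity)]; simp

theorem sqrt_two_bounds : 1.414 < Real.sqrt 2 ∧ Real.sqrt 2 < 1.415 :=
  ⟨by rw [Real.lt_sqrt] <;> norm_num, by rw [Real.sqrt_lt'] <;> norm_num⟩

theorem modelTheta_pos {r : ℕ} (hr : 1 ≤ r) : 0 < modelTheta r := by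
  have := sqrt_two_bounds
  have hr' : (0 : ℝ) < r := by exact_mod_cast hr
  rw [modelTheta, one_div_sqrt_two]
  have : (0 : ℝ) < 1 - Real.sqrt 2 / 2 := by linarith
  positivity

theorem modelTheta_le_one {r : ℕ} (hr : 1 ≤ r) : modelTheta r ≤ 1 := by
  have := sqrt_two_bounds
  have hr' : (1 : ℝ) ≤ r := by exact_mod_cast hr
  rw [modelTheta, one_div_sqrt_two, div_le_one (by positivity)]
  nlinarith

-- Twice `modelTheta r` equals `(1 - cos (π/4)) / r²`, which is at most `1 - cos (π/(4r))`. Hence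
-- the evaluation point is `cos φ` with `φ ≤ π/(4r)`: it lies to the right of the node `cos (π/r)`,
-- and there the Chebyshev polynomial equals `cos (r φ) ≥ cos (π/4)`.
open Polynomial Polynomial.Chebyshev in
theorem sqrt_two_div_two_le_eval {r : ℕ} (hr : 1 ≤ r) {P : ℝ[X]} (hdeg : P.degree ≤ r)
    (hbd : ∀ x ∈ Set.Icc (-1 : ℝ) 1, |P.eval x| ≤ 1) (h1 : P.eval 1 = 1) :
    Real.sqrt 2 / 2 ≤ P.eval (1 - 2 * modelTheta r) := by
  have hr' : (1 : ℝ) ≤ r := by exact_mod_cast hr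
  have hθ := modelTheta_pos hr
  have hθ1 := modelTheta_le_one hr
  have hπ := Real.pi_pos
  have hψ0 : 0 ≤ Real.pi / (4 * r) := by positivity
  have hψ1 : Real.pi / (4 * r) ≤ Real.pi / r := by gcongr; linarith
  have hψ2 : Real.pi / r ≤ Real.pi := div_le_self hπ.le hr'
  have hcos : Real.cos (Real.pi / (4 * r)) ≤ 1 - 2 * modelTheta r := by
    have h := one_sub_cos_nat_mul_le r (Real.pi / (4 * r))
    rw [show (r : ℝ) * (Real.pi / (4 * r)) = Real.pi / 4 by field_simp, Real.cos_pi_div_four] at h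
    have : 2 * modelTheta r = (1 - Real.sqrt 2 / 2) / r ^ 2 := by
      rw [modelTheta, one_div_sqrt_two]; field_simp
    rw [this]
    have : (1 - Real.sqrt 2 / 2) / r ^ 2 ≤ 1 - Real.cos (Real.pi / (4 * r)) := by
      rw [div_le_iff₀ (by positivity)]; linarith
    linarith
  have hnode : node r 1 ≤ 1 - 2 * modelTheta r := by
    refine le_trans ?_ hcos
    rw [node, Nat.cast_one, one_mul]
    exact Real.cos_le_cos_of_nonneg_of_le_pi hψ0 hψ2 hψ1
  refine le_trans ?_ (eval_T_le_eval hdeg hbd h1 hnode (by linarith))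
  have harc : Real.cos (Real.arccos (1 - 2 * modelTheta r)) = 1 - 2 * modelTheta r :=
    Real.cos_arccos (by linarith) (by linarith)
  rw [← harc, T_real_cos]
  have hle : Real.arccos (1 - 2 * modelTheta r) ≤ Real.pi / (4 * r) := by
    rw [← Real.arccos_cos hψ0 (hψ1.trans hψ2)]
    exact Real.arccos_le_arccos hcos
  have h0 := Real.arccos_nonneg (1 - 2 * modelTheta r)
  rw [← Real.cos_pi_div_four]
  have hr4 : (r : ℝ) * Real.arccos (1 - 2 * modelTheta r) ≤ Real.pi / 4 := by
    calc _ ≤ (r : ℝ) * (Real.pi / (4 * r)) := by gcongr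
      _ = _ := by field_simp
  push_cast
  exact Real.cos_le_cos_of_nonneg_of_le_pi (by positivity) (by linarith) hr4

/-- A polynomial that attains its maximal absolute value over a segment at an endpoint stays close
to its value there. -/
theorem MvPolynomial.sq_eval_le_mul_eval {d r : ℕ} (hr : 1 ≤ r) {g : MvPolynomial (Fin d) ℝ}
    (hg : g.totalDegree ≤ r) {x y : Rd d}
    (hbd : ∀ t ∈ Set.Icc (0 : ℝ) 1, |eval ((1 - t) • x + t • y) g| ≤ |eval x g|) :
    Real.sqrt 2 / 2 * (eval x g) ^ 2 ≤
      eval x g * eval ((1 - modelTheta r) • x + modelTheta r • y) g := by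
  by_cases hx : eval x g = 0
  · simp [hx]
  -- The segment is parametrised by `[-1, 1]` with `1 ↦ x` and `-1 ↦ y`, so that `1 - 2 t`
  -- corresponds to `(1 - t) x + t y`; dividing by the value at `x` gives `P 1 = 1`.
  let φ : Fin d → Polynomial ℝ := fun i =>
    Polynomial.C ((x i + y i) / 2) + Polynomial.C ((x i - y i) / 2) * Polynomial.X
  let P : Polynomial ℝ := Polynomial.C (eval x g)⁻¹ * aeval φ g
  have hP : ∀ t : ℝ, P.eval (1 - 2 * t) = (eval x g)⁻¹ * eval ((1 - t) • x + t • y) g := by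
    intro t
    rw [Polynomial.eval_mul, Polynomial.eval_C]
    congr 1
    have hom : (Polynomial.evalRingHom (1 - 2 * t)).comp (aeval φ).toRingHom =
        eval ((1 - t) • x + t • y) := by
      refine MvPolynomial.ringHom_ext (fun a => by simp) fun i => ?_
      simp [φ]
      ring
    exact RingHom.congr_fun hom g
  have hdeg : P.degree ≤ r := by
    refine Polynomial.degree_le_of_natDegree_le ?_
    refine (Polynomial.natDegree_C_mul_le _ _).trans ?_
    refine (MvPolynomial.aeval_natDegree_le g hg φ (n := 1) fun i => ?_).trans (by omega)
    refine Polynomial.natDegree_add_le_of_degree_le (by simp) ?_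
    exact (Polynomial.natDegree_C_mul_le _ _).trans Polynomial.natDegree_X_le
  have h1 : P.eval 1 = 1 := by
    have := hP 0
    simpa [hx] using this
  have hb : ∀ s ∈ Set.Icc (-1 : ℝ) 1, |P.eval s| ≤ 1 := by
    intro s hs
    have h := hP ((1 - s) / 2)
    rw [show 1 - 2 * ((1 - s) / 2) = s by ring] at h
    rw [h, abs_mul, abs_inv]
    rw [inv_mul_le_iff₀ (abs_pos.2 hx), mul_one]
    exact hbd _ ⟨by linarith [hs.2], by linarith [hs.1]⟩
  have h := sqrt_two_div_two_le_eval hr hdeg hb h1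
  rw [hP] at h
  have h2 : 0 < (eval x g) ^ 2 := by positivity
  calc _ ≤ ((eval x g)⁻¹ * eval ((1 - modelTheta r) • x + modelTheta r • y) g) *
        (eval x g) ^ 2 := by gcongr
    _ = _ := by field_simp

/-! ### Boxes, test sets and the model -/

theorem thetaM_hModel {d r : ℕ} (hr : 1 ≤ r) (hd : 1 ≤ d) {cells : Set (Set (Rd d))}
    (h0 : 0 < minCellVolume cells) :
    thetaM r d (minCellVolume cells) (hModel r cells) = modelTheta r := by
  obtain ⟨s1, s2⟩ := sqrt_two_bounds
  have hr' : (0 : ℝ) < r := by exact_mod_cast hr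
  have hd' : (1 : ℝ) ≤ d := by exact_mod_cast hd
  set κ : ℝ := 1 - 1 / Real.sqrt 2 with hκ
  have hκ' : κ = 1 - Real.sqrt 2 / 2 := by rw [hκ, one_div_sqrt_two]
  have hκ0 : 0 < κ := by rw [hκ']; linarith
  set b : ℝ := 2 * (r : ℝ) ^ 2 with hb
  have hb0 : 0 < b := by positivity
  have hu : hModel r cells / minCellVolume cells = κ ^ (d + 1) / b ^ d := by
    rw [hModel, ← hκ, ← hb]; field_simp
  have hd1 : ((d : ℝ) + 1) = ((d + 1 : ℕ) : ℝ) := by push_cast; ring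
  have hroot : b ^ ((d : ℝ) / (d + 1)) * (κ ^ (d + 1) / b ^ d) ^ (1 / ((d : ℝ) + 1)) = κ := by
    rw [Real.div_rpow (by positivity) (by positivity), hd1, one_div,
      Real.pow_rpow_inv_natCast hκ0.le (by omega), ← Real.rpow_natCast b d, ← Real.rpow_mul hb0.le,
      ← div_eq_mul_inv]
    field_simp
  -- The second bound equals `(1 - κ)² = 1/2`, whereas the first is at most `1/(2(d+1)) ≤ 1/4`; so
  -- the root branch of `thetaM` applies.
  have hne : gammaRD r d (κ ^ (d + 1) / b ^ d) ≠ gammaFst r d (κ ^ (d + 1) / b ^ d) := by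
    apply ne_of_gt
    refine lt_of_lt_of_le ?_ (le_max_right _ _)
    rw [← hb, hroot, max_eq_left (by rw [hκ']; linarith)]
    refine lt_of_le_of_lt (mul_le_mul_of_nonneg_left (min_le_right _ _) (by positivity)) ?_
    have : 1 / (2 * ((d : ℝ) + 1)) ≤ 1 / 4 := by gcongr; linarith
    rw [hκ']
    nlinarith
  rw [thetaM, hu, if_neg hne, modelTheta, ← hκ, ← hb]
  have : hModel r cells / (b * minCellVolume cells) = (κ / b) ^ (d + 1) := by
    rw [hModel, ← hκ, ← hb, div_pow, pow_succ b]; field_simp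
  rw [this, hd1, one_div, Real.pow_rpow_inv_natCast (by positivity) (by omega)]

theorem measurableSet_of_mem_boxes {d : ℕ} {S : Set (Rd d)} (hS : S ∈ boxes d) :
    MeasurableSet S := by
  obtain ⟨J, hJ, rfl⟩ := hS
  exact MeasurableSet.univ_pi fun i => (hJ i).measurableSet

theorem convex_of_mem_boxes {d : ℕ} {S : Set (Rd d)} (hS : S ∈ boxes d) : Convex ℝ S := by
  obtain ⟨J, hJ, rfl⟩ := hS
  exact convex_pi fun i _ => (hJ i).convex

theorem image_interior_mem_boxes {d : ℕ} {S : Set (Rd d)} (hS : S ∈ boxes d) (x : Rd d) (θ : ℝ) :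
    (fun y => (1 - θ) • x + θ • y) '' interior S ∈ boxes d := by
  obtain ⟨J, hJ, rfl⟩ := hS
  refine ⟨fun i => (fun t => (1 - θ) * x i + θ • t) '' interior (J i), fun i => ?_, ?_⟩
  · exact (Convex.affinity ((hJ i).convex.interior) _ θ).ordConnected
  · rw [interior_pi_set Set.finite_univ, ← Set.piMap_image_univ_pi]
    rfl

/-- The map is a homothety of ratio `θ`, and passing to the interior costs no volume because the
frontier of a convex set is null. -/
theorem volume_image_interior {d : ℕ} {S : Set (Rd d)} (hS : S ∈ boxes d) (x : Rd d) {θ : ℝ}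
    (hθ : 0 ≤ θ) :
    volume.real ((fun y => (1 - θ) • x + θ • y) '' interior S) = θ ^ d * volume.real S := by
  have h1 : (fun y => (1 - θ) • x + θ • y) = AffineMap.homothety x θ := by
    funext y
    rw [AffineMap.homothety_apply, vsub_eq_sub, vadd_eq_add]
    module
  have h2 : volume (interior S) = volume S :=
    measure_congr (interior_ae_eq_of_null_frontier
      ((convex_of_mem_boxes hS).addHaar_frontier volume))
  rw [h1, Measure.real, Measure.addHaar_image_homothety, h2, ENNReal.toReal_mul, Module.finrank_fin_fun,
    ENNReal.toReal_ofReal (abs_nonneg _), abs_of_nonneg (by positivity), Measure.real]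

theorem minCellVolume_le {d : ℕ} {cells : Set (Set (Rd d))} {I : Set (Rd d)} (hI : I ∈ cells) :
    minCellVolume cells ≤ volume.real I :=
  csInf_le ⟨0, by rintro _ ⟨J, _, rfl⟩; exact measureReal_nonneg⟩ ⟨I, hI, rfl⟩

theorem eLpNorm_top_le_of_cells {d : ℕ} {cells : Set (Set (Rd d))} (hcells : IsBoxPartition cells)
    {f : Rd d → ℝ} {M : ℝ≥0∞} (hf : ∀ J ∈ cells, eLpNorm (J.indicator f) ∞ volume ≤ M) :
    eLpNorm f ∞ volume ≤ M := by
  rw [eLpNorm_exponent_top]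
  refine eLpNormEssSup_le_of_ae_enorm_bound ?_
  have : ∀ᵐ y : Rd d, ∀ J ∈ cells, ‖J.indicator f y‖ₑ ≤ M := by
    rw [ae_ball_iff hcells.countable]
    intro J hJ
    filter_upwards [ae_le_eLpNormEssSup (f := J.indicator f) (μ := volume)] with y hy
    exact hy.trans (by rw [← eLpNorm_exponent_top]; exact hf J hJ)
  filter_upwards [this] with y hy
  obtain ⟨J, ⟨hJ, hyJ⟩, -⟩ := hcells.partition.2 y
  simpa [hyJ] using hy J hJ

/-- Restriction of an element of the model to a cell. -/
theorem exists_mvPolynomial_of_mem_piecewisePoly {d r : ℕ} {cells : Set (Set (Rd d))}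
    {f : Rd d → ℝ} (hf : f ∈ piecewisePoly r cells) {I : Set (Rd d)} (hI : I ∈ cells) :
    ∃ g : MvPolynomial (Fin d) ℝ, g.totalDegree ≤ r ∧ ∀ y ∈ I, f y = MvPolynomial.eval y g := by
  obtain ⟨g, hg, -, hfg⟩ := hf
  refine ⟨MvPolynomial.map (algebraMap ℚ ℝ) (g I), ?_, fun y hy => ?_⟩
  · exact (Finset.sup_mono (MvPolynomial.support_map_subset _ _)).trans (hg I hI)
  · rw [hfg I hI y hy, MvPolynomial.aeval_def, MvPolynomial.eval_map]

theorem MvPolynomial.integrableOn_eval {d : ℕ} (g : MvPolynomial (Fin d) ℝ) {S : Set (Rd d)}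
    (hS : Bornology.IsBounded S) : IntegrableOn (fun y => eval y g) S volume :=
  ((MvPolynomial.continuous_eval g).continuousOn.integrableOn_compact
    hS.isCompact_closure).mono_set subset_closure

theorem integrableOn_of_mem_piecewisePoly {d r : ℕ} {cells : Set (Set (Rd d))}
    (hcells : IsBoxPartition cells) {f : Rd d → ℝ} (hf : f ∈ piecewisePoly r cells)
    {I : Set (Rd d)} (hI : I ∈ cells) : IntegrableOn f I volume := by
  obtain ⟨g, -, hg⟩ := exists_mvPolynomial_of_mem_piecewisePoly hf hI
  exact (integrableOn_congr_fun hg (measurableSet_of_mem_boxes (hcells.subset_boxes hI))).2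
    (g.integrableOn_eval (hcells.bounded I hI))

theorem sub_mem_piecewisePoly {d r : ℕ} {cells : Set (Set (Rd d))} {f g : Rd d → ℝ}
    (hf : f ∈ piecewisePoly r cells) (hg : g ∈ piecewisePoly r cells) :
    f - g ∈ piecewisePoly r cells := by
  obtain ⟨a, ha, ha', hfa⟩ := hf
  obtain ⟨b, hb, hb', hgb⟩ := hg
  refine ⟨a - b, fun I hI => ?_, (ha'.union hb').subset ?_, fun I hI x hx => ?_⟩
  · exact (MvPolynomial.totalDegree_sub _ _).trans (max_le (ha I hI) (hb I hI))
  · rintro I ⟨hI, hne⟩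
    by_contra h
    simp only [Set.mem_union, Set.mem_ofPred_eq, hI, true_and, not_or, not_not] at h
    exact hne (by simp [h.1, h.2])
  · simp [hfa I hI x hx, hgb I hI x hx]

/-- Integrate the pointwise bound and divide by `|c|`. Keeping the factor `c` in the hypothesis
treats both signs of the extremal value together. -/
theorem sqrt_two_div_two_mul_le_abs_setIntegral {d : ℕ} {C : Set (Rd d)} (hC : MeasurableSet C)
    (hfin : volume C ≠ ∞) {f : Rd d → ℝ} (hint : IntegrableOn f C volume) {c : ℝ}
    (hf : ∀ z ∈ C, Real.sqrt 2 / 2 * c ^ 2 ≤ c * f z) :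
    Real.sqrt 2 / 2 * |c| * volume.real C ≤ |∫ y in C, f y| := by
  rcases eq_or_ne c 0 with rfl | hc
  · simp
  have h1 : ∫ _ in C, Real.sqrt 2 / 2 * c ^ 2 ≤ ∫ y in C, c * f y :=
    setIntegral_mono_on (integrableOn_const hfin) (hint.const_mul c) hC hf
  rw [setIntegral_const, integral_const_mul, smul_eq_mul] at h1
  have h2 : c * ∫ y in C, f y ≤ |c| * |∫ y in C, f y| := by
    rw [← abs_mul]; exact le_abs_self _
  have h3 : 0 < |c| := abs_pos.2 hc
  rw [← sq_abs] at h1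
  refine le_of_mul_le_mul_left ?_ h3
  calc _ = volume.real C * (Real.sqrt 2 / 2 * |c| ^ 2) := by ring
    _ ≤ _ := h1.trans h2

theorem hModel_pos {d r : ℕ} (hr : 1 ≤ r) {cells : Set (Set (Rd d))}
    (h0 : 0 < minCellVolume cells) : 0 < hModel r cells := by
  have h2 : 0 < 1 - 1 / Real.sqrt 2 := by
    rw [one_div_sqrt_two]; linarith [sqrt_two_bounds.2]
  have hr' : (0 : ℝ) < r := by exact_mod_cast hr
  rw [hModel]; positivity

/-- The properties of the test sets. -/
theorem IsTestSet.properties {d r : ℕ} (hr : 1 ≤ r) (hd : 1 ≤ d) {cells : Set (Set (Rd d))}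
    (hcells : IsBoxPartition cells) {f : Rd d → ℝ} (hf : f ∈ piecewisePoly r cells)
    {C : Set (Rd d)} (hC : IsTestSet r cells (hModel r cells) f C) :
    C ∈ boxes d ∧ (∃ I ∈ cells, C ⊆ I) ∧
      eLpNorm f ∞ volume ≤
        ENNReal.ofReal (2 * |∫ y in C, f y| / (volume.real C + hModel r cells)) := by
  obtain ⟨I, hI, hmax, g, hfg, x, hx, hgx, hCeq⟩ := hC
  rw [thetaM_hModel hr hd hcells.volume_pos] at hCeq
  have hIbox := hcells.subset_boxes hI
  have hIconv := convex_of_mem_boxes hIbox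
  have hθ0 := modelTheta_pos hr
  have hθ1 := modelTheta_le_one hr
  have hCbox : C ∈ boxes d := hCeq ▸ image_interior_mem_boxes hIbox _ _
  have hCI : C ⊆ I := by
    rintro _ hz
    rw [hCeq] at hz
    obtain ⟨y, hy, rfl⟩ := hz
    have := hIconv.combo_closure_interior_mem_interior hx hy (a := 1 - modelTheta r)
      (b := modelTheta r) (by linarith) hθ0 (by ring)
    exact interior_subset this
  refine ⟨hCbox, ⟨I, hI, hCI⟩, ?_⟩
  have hCm := measurableSet_of_mem_boxes hCbox
  have hCfin : volume C ≠ ∞ := (((hcells.bounded I hI).subset hCI).measure_lt_top).ne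
  -- The polynomial in `IsTestSet` carries no degree bound; it is exchanged for one that does, the
  -- two agreeing on the closure of the cell by continuity.
  obtain ⟨g', hg'deg, hfg'⟩ := exists_mvPolynomial_of_mem_piecewisePoly hf hI
  have hgg' : Set.EqOn (fun y => MvPolynomial.eval y g) (fun y => MvPolynomial.eval y g')
      (closure I) :=
    Set.EqOn.closure (fun y hy => (hfg y hy).symm.trans (hfg' y hy))
      (MvPolynomial.continuous_eval g) (MvPolynomial.continuous_eval g')
  set M := MvPolynomial.eval x g' with hM
  have hbound : ∀ y ∈ closure I, |MvPolynomial.eval y g'| ≤ |M| := by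
    intro y hy
    have h1 := hgx y hy
    rw [show MvPolynomial.eval y g = _ from hgg' hy, show MvPolynomial.eval x g = _ from hgg' hx]
      at h1
    exact h1
  have hnorm : eLpNorm f ∞ volume ≤ ENNReal.ofReal |M| := by
    refine eLpNorm_top_le_of_cells hcells fun J hJ => (hmax J hJ).trans ?_
    rw [eLpNorm_exponent_top]
    refine eLpNormEssSup_le_of_ae_enorm_bound (.of_forall fun y => ?_)
    by_cases hy : y ∈ I
    · rw [Set.indicator_of_mem hy, Real.enorm_eq_ofReal_abs, hfg' y hy]
      exact ENNReal.ofReal_le_ofReal (hbound y (subset_closure hy))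
    · simp [hy]
  have hpt : ∀ z ∈ C, Real.sqrt 2 / 2 * M ^ 2 ≤ M * f z := by
    intro z hz
    rw [hfg' z (hCI hz)]
    rw [hCeq] at hz
    obtain ⟨y, hy, rfl⟩ := hz
    refine MvPolynomial.sq_eval_le_mul_eval hr hg'deg fun t ht => hbound _ ?_
    exact hIconv.closure hx (subset_closure (interior_subset hy)) (by linarith [ht.2]) ht.1 (by ring)
  have hlow := sqrt_two_div_two_mul_le_abs_setIntegral hCm hCfin
    ((integrableOn_of_mem_piecewisePoly hcells hf hI).mono_set hCI) hpt
  -- This is what fixes `hModel`: one factor `1 - 1/√2` remains after `θ ^ d` is absorbed in the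
  -- volume of `C`. Then `volume.real C + h ≤ (2 - √2/2) volume.real C ≤ √2 volume.real C`, and with
  -- the lower bound `√2/2` the final constant is `2`.
  have hvol : hModel r cells ≤ (1 - Real.sqrt 2 / 2) * volume.real C := by
    rw [hCeq, volume_image_interior hIbox x hθ0.le, hModel, one_div_sqrt_two, modelTheta,
      one_div_sqrt_two, div_pow, pow_succ]
    have h1 := minCellVolume_le hI
    have h2 : 0 < 1 - Real.sqrt 2 / 2 := by linarith [sqrt_two_bounds.2]
    have hr' : (0 : ℝ) < r := by exact_mod_cast hr
    calc _ = (1 - Real.sqrt 2 / 2) * ((1 - Real.sqrt 2 / 2) ^ d / (2 * (r : ℝ) ^ 2) ^ d *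
          minCellVolume cells) := by ring
      _ ≤ _ := by gcongr
  have hh : 0 < hModel r cells := hModel_pos hr hcells.volume_pos
  have hv0 : 0 ≤ volume.real C := measureReal_nonneg
  refine hnorm.trans (ENNReal.ofReal_le_ofReal ?_)
  rw [le_div_iff₀ (by positivity)]
  have : |M| * (volume.real C + hModel r cells) ≤
      |M| * ((2 - Real.sqrt 2 / 2) * volume.real C) := by gcongr; linarith
  have h5 : |M| * ((2 - Real.sqrt 2 / 2) * volume.real C) ≤
      |M| * (Real.sqrt 2 * volume.real C) := by
    gcongr; linarith [sqrt_two_bounds.1]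
  nlinarith

/-! ### Bracketing of boxes by a finite grid -/

theorem continuous_cdf (ν : Measure ℝ) [IsProbabilityMeasure ν] [NullSingletonClass ν] :
    Continuous (cdf ν) := by
  refine continuous_iff_continuousAt.2 fun a => ?_
  rw [(monotone_cdf ν).continuousAt_iff_leftLim_eq_rightLim, StieltjesFunction.rightLim_eq]
  have h : (cdf ν).measure {a} = 0 := by rw [measure_cdf]; exact measure_singleton a
  rw [StieltjesFunction.measure_singleton, ENNReal.ofReal_eq_zero] at h
  exact le_antisymm ((monotone_cdf ν).leftLim_le le_rfl) (by linarith)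

/-- Without atoms the distribution function takes every value in `(0, 1)`. The extreme levels are
forced to be `∅` and the whole line so that every lower set lies between two levels. -/
theorem exists_isLowerSet_measureReal_eq (ν : Measure ℝ) [IsProbabilityMeasure ν] [NullSingletonClass ν]
    {c : ℝ} (h0 : 0 ≤ c) (h1 : c ≤ 1) :
    ∃ S : Set ℝ, IsLowerSet S ∧ ν.real S = c ∧ (c = 0 → S = ∅) ∧ (c = 1 → S = Set.univ) := by
  rcases h0.eq_or_lt with rfl | h0
  · exact ⟨∅, isLowerSet_empty, by simp, by simp, by simp⟩
  rcases h1.eq_or_lt with rfl | h1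
  · exact ⟨Set.univ, isLowerSet_univ, by simp, by simp, by simp⟩
  obtain ⟨t, ht⟩ : c ∈ Set.range (cdf ν) := by
    refine mem_range_of_exists_le_of_exists_ge (continuous_cdf ν) ?_ ?_
    · exact ((tendsto_cdf_atBot ν).eventually (eventually_le_nhds h0)).exists
    · exact ((tendsto_cdf_atTop ν).eventually (eventually_ge_nhds h1)).exists
  exact ⟨Set.Iic t, isLowerSet_Iic t, by rw [← cdf_eq_real, ht], fun h => absurd h h0.ne',
    fun h => absurd h h1.ne⟩

theorem IsLowerSet.measurableSet_real {S : Set ℝ} (hS : IsLowerSet S) : MeasurableSet S :=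
  hS.ordConnected.measurableSet

/-- Lower sets of the line are totally ordered by inclusion, so `L` falls between consecutive
quantile sets of masses `k/N` and `(k+1)/N`, where `k < N` is the last index with `S k ⊆ L`. -/
theorem exists_lowerSet_chain (ν : Measure ℝ) [IsProbabilityMeasure ν] [NullSingletonClass ν] {N : ℕ}
    (hN : 1 ≤ N) :
    ∃ S : Fin (N + 1) → Set ℝ, (∀ k, IsLowerSet (S k)) ∧ ∀ L : Set ℝ, IsLowerSet L →
      ∃ k l, S k ⊆ L ∧ L ⊆ S l ∧ ν.real (S l \ S k) ≤ 1 / N := by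
  have hN' : (0 : ℝ) < N := by exact_mod_cast hN
  have hc : ∀ k : Fin (N + 1), ((k : ℕ) : ℝ) / N ≤ 1 := fun k => by
    rw [div_le_one hN']; exact_mod_cast Nat.lt_succ_iff.1 k.2
  choose S hS hSν hS0 hS1 using fun k : Fin (N + 1) =>
    exists_isLowerSet_measureReal_eq ν (c := ((k : ℕ) : ℝ) / N) (by positivity) (hc k)
  refine ⟨S, hS, fun L hL => ?_⟩
  classical
  have h0 : S 0 ⊆ L := by rw [hS0 0 (by simp)]; exact Set.empty_subset _
  obtain ⟨k, hk, hkmax⟩ := Finset.exists_max_image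
    (Finset.univ.filter fun k : Fin (N + 1) => k.1 < N ∧ S k ⊆ L) (fun k => k.1)
    ⟨0, by simpa using ⟨by omega, h0⟩⟩
  simp only [Finset.mem_filter, Finset.mem_univ, true_and] at hk hkmax
  let l : Fin (N + 1) := ⟨k.1 + 1, by omega⟩
  have hLl : L ⊆ S l := by
    by_cases hl : l.1 < N
    · refine ((hS l).total hL).resolve_left fun h => ?_
      have := hkmax l ⟨hl, h⟩
      simp [l] at this
    · rw [hS1 l]
      · exact Set.subset_univ _
      · rw [show l.1 = N by omega, div_self hN'.ne']
  refine ⟨k, l, hk.2, hLl, ?_⟩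
  rw [measureReal_sdiff (hk.2.trans hLl) (hS k).measurableSet_real, hSν, hSν, ← sub_div]
  simp [l]

/-- The boxes of a grid bracket all boxes, up to a small probability. -/
theorem exists_box_bracketing {d N : ℕ} (hN : 1 ≤ N) (Q : Measure (Rd d)) [IsProbabilityMeasure Q]
    (hQ : Q ≪ volume) :
    ∃ B : (Fin d → Fin (N + 1) × Fin (N + 1)) → Set (Rd d), (∀ i, MeasurableSet (B i)) ∧
      ∀ C ∈ boxes d, ∃ i j, B i ⊆ C ∧ C ⊆ B j ∧ Q.real (B j \ B i) ≤ 2 * d / N := by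
  have hprob : ∀ j, IsProbabilityMeasure (Q.map (Function.eval j)) := fun j =>
    Measure.isProbabilityMeasure_map (measurable_pi_apply j).aemeasurable
  have hatoms : ∀ j : Fin d, NullSingletonClass (Q.map (Function.eval j)) := fun j => ⟨fun t => by
    rw [Measure.map_apply (measurable_pi_apply j) (measurableSet_singleton t)]
    exact hQ (Measure.pi_hyperplane (fun _ : Fin d => (volume : Measure ℝ)) j t)⟩
  choose S hS hbr using fun j : Fin d =>
    exists_lowerSet_chain (Q.map (Function.eval j)) hN
  refine ⟨fun i => Set.univ.pi fun j => S j (i j).2 \ S j (i j).1, fun i =>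
    MeasurableSet.univ_pi fun j => (hS j _).measurableSet_real.diff (hS j _).measurableSet_real, ?_⟩
  rintro _ ⟨J, hJ, rfl⟩
  choose k l hk hl hkl using fun j => hbr j _ (lowerClosure (J j)).lower
  choose k' l' hk' hl' hkl' using fun j => hbr j _ (upperClosure (J j)).upper.compl
  -- An interval is thus a difference of two lower sets. Bracketing each of them costs `1/N`, hence
  -- `2/N` per coordinate.
  have hJeq : ∀ j, J j = ↑(upperClosure (J j)) ∩ ↑(lowerClosure (J j)) := fun j =>
    (hJ j).upperClosure_inter_lowerClosure.symm
  refine ⟨fun j => (l' j, k j), fun j => (k' j, l j), ?_, ?_, ?_⟩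
  · refine Set.pi_mono fun j _ x hx => ?_
    rw [hJeq j]
    exact ⟨by_contra fun h => hx.2 (hl' j h), hk j hx.1⟩
  · refine Set.pi_mono fun j _ x hx => ?_
    rw [hJeq j] at hx
    exact ⟨hl j hx.2, fun h => hk' j h hx.1⟩
  · have hsub : (Set.univ.pi fun j => S j (l j) \ S j (k' j)) \
        (Set.univ.pi fun j => S j (k j) \ S j (l' j)) ⊆
        ⋃ j, Function.eval j ⁻¹' ((S j (l j) \ S j (k j)) ∪ (S j (l' j) \ S j (k' j))) := by
      rintro x ⟨hx1, hx2⟩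
      simp only [Set.mem_pi, Set.mem_univ, true_implies, not_forall] at hx1 hx2
      obtain ⟨j, hj⟩ := hx2
      refine Set.mem_iUnion.2 ⟨j, ?_⟩
      have := hx1 j
      simp only [Set.mem_preimage, Set.mem_union, Set.mem_sdiff, Function.eval] at *
      tauto
    have hone : ∀ j : Fin d, Q.real (Function.eval j ⁻¹'
        ((S j (l j) \ S j (k j)) ∪ (S j (l' j) \ S j (k' j)))) ≤ 2 / N := by
      intro j
      rw [← map_measureReal_apply (measurable_pi_apply j)
        (((hS j _).measurableSet_real.diff (hS j _).measurableSet_real).union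
        ((hS j _).measurableSet_real.diff (hS j _).measurableSet_real))]
      refine (measureReal_union_le _ _).trans ?_
      have e : (2 : ℝ) / N = 1 / N + 1 / N := by ring
      rw [e]
      exact add_le_add (hkl j) (hkl' j)
    calc _ ≤ _ := measureReal_mono hsub
      _ ≤ ∑ j : Fin d, Q.real (Function.eval j ⁻¹'
          ((S j (l j) \ S j (k j)) ∪ (S j (l' j) \ S j (k' j)))) :=
        measureReal_iUnion_fintype_le _
      _ ≤ ∑ _j : Fin d, (2 : ℝ) / N := Finset.sum_le_sum fun j _ => hone j
      _ = _ := by simp; ring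

/-! ### Exponential moments and deviations over finitely many events -/

section Deviations

variable {Ω E : Type*} [MeasurableSpace Ω] [MeasurableSpace E] {P : Measure Ω}
  [IsProbabilityMeasure P] {n : ℕ} {X : Fin n → Ω → E}

theorem mgf_indicator_le {Y : Ω → E} (hY : Measurable Y) {B : Set E} (hB : MeasurableSet B)
    (t : ℝ) :
    mgf (fun ω => B.indicator (fun _ => (1 : ℝ)) (Y ω)) P t ≤
      Real.exp ((Real.exp t - 1) * (P.map Y).real B) := by
  have heq : (fun ω => Real.exp (t * B.indicator (fun _ => (1 : ℝ)) (Y ω))) =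
      fun ω => 1 + (Y ⁻¹' B).indicator (fun _ => Real.exp t - 1) ω := by
    funext ω
    by_cases h : Y ω ∈ B
    · rw [Set.indicator_of_mem h, Set.indicator_of_mem (by exact h)]; simp
    · rw [Set.indicator_of_notMem h, Set.indicator_of_notMem (by exact h)]; simp
  rw [mgf, heq, integral_add (integrable_const _)
    ((integrable_const _).indicator (hY hB)), integral_indicator_const _ (hY hB),
    ← map_measureReal_apply hY hB]
  simp only [integral_const, probReal_univ, smul_eq_mul, one_mul]
  have := Real.add_one_le_exp ((Real.exp t - 1) * (P.map Y).real B)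
  linarith

/-- By independence the moment generating function is at most `exp ((e^t - 1) V)`, with `V` the
expected count, and `e^t - 1 ≤ t + t²` for `|t| ≤ 1`. Only the individual laws enter, so they may
differ. -/
theorem lintegral_exp_sum_indicator_le (hX : ∀ i, Measurable (X i)) (hindep : iIndepFun X P)
    {B : Set E} (hB : MeasurableSet B) {t : ℝ} (ht : |t| ≤ 1) :
    ∫⁻ ω, ENNReal.ofReal (Real.exp (t * (∑ i, B.indicator (fun _ => (1 : ℝ)) (X i ω)) -
      (t + t ^ 2) * ∑ i, (P.map (X i)).real B)) ∂P ≤ 1 := by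
  set V := ∑ i, (P.map (X i)).real B with hV
  have hV0 : 0 ≤ V := Finset.sum_nonneg fun i _ => measureReal_nonneg
  have hind : Measurable (B.indicator fun _ => (1 : ℝ)) := measurable_const.indicator hB
  have hY : ∀ i, Measurable fun ω => B.indicator (fun _ => (1 : ℝ)) (X i ω) := fun i =>
    hind.comp (hX i)
  have hmgf := (hindep.comp (fun _ => B.indicator fun _ => (1 : ℝ)) fun _ => hind).mgf_sum
    (t := t) hY Finset.univ
  have hle : mgf (∑ i, fun ω => B.indicator (fun _ => (1 : ℝ)) (X i ω)) P t ≤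
      Real.exp ((Real.exp t - 1) * V) := by
    rw [hV, Finset.mul_sum, Real.exp_sum]
    refine hmgf.trans_le (Finset.prod_le_prod (fun i _ => mgf_nonneg) fun i _ => ?_)
    exact mgf_indicator_le (hX i) hB t
  have hmeas : Measurable fun ω => Real.exp (t * (∑ i, B.indicator (fun _ => (1 : ℝ)) (X i ω)) -
      (t + t ^ 2) * V) := by fun_prop
  have hbd : ∀ ω, ∑ i, B.indicator (fun _ => (1 : ℝ)) (X i ω) ∈ Set.Icc (0 : ℝ) n := by
    intro ω
    refine ⟨Finset.sum_nonneg fun i _ => Set.indicator_nonneg (by simp) _, ?_⟩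
    calc ∑ i, B.indicator (fun _ => (1 : ℝ)) (X i ω) ≤ ∑ _i : Fin n, (1 : ℝ) := Finset.sum_le_sum fun i _ =>
          Set.indicator_apply_le' (fun _ => le_rfl) fun _ => zero_le_one
      _ = n := by simp
  have hint : Integrable (fun ω => Real.exp (t * (∑ i, B.indicator (fun _ => (1 : ℝ)) (X i ω)) -
      (t + t ^ 2) * V)) P := by
    refine Integrable.of_bound hmeas.aestronglyMeasurable
      (Real.exp (n - (t + t ^ 2) * V)) (.of_forall fun ω => ?_)
    rw [Real.norm_eq_abs, Real.abs_exp]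
    refine Real.exp_le_exp.2 (sub_le_sub_right ?_ _)
    obtain ⟨h1, h2⟩ := hbd ω
    have := (abs_le.1 ht).2
    nlinarith
  rw [← ofReal_integral_eq_lintegral_ofReal hint (.of_forall fun ω => (Real.exp_pos _).le)]
  rw [ENNReal.ofReal_le_one]
  have hexp := (abs_le.1 (Real.abs_exp_sub_one_sub_id_le ht)).2
  calc _ = mgf (∑ i, fun ω => B.indicator (fun _ => (1 : ℝ)) (X i ω)) P t *
        Real.exp (-((t + t ^ 2) * V)) := by
        rw [mgf, ← integral_mul_const]
        refine integral_congr_ae (.of_forall fun ω => ?_)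
        simp only [Finset.sum_apply, ← Real.exp_add, sub_eq_add_neg]
    _ ≤ Real.exp ((Real.exp t - 1) * V) * Real.exp (-((t + t ^ 2) * V)) := by gcongr
    _ = Real.exp ((Real.exp t - 1 - t - t ^ 2) * V) := by rw [← Real.exp_add]; ring_nf
    _ ≤ 1 := Real.exp_le_one_iff.2 (mul_nonpos_of_nonpos_of_nonneg (by linarith) hV0)

/-- A maximal deviation inequality for finitely many events. -/
theorem exists_deviation_bound (hX : ∀ i, Measurable (X i)) (hindep : iIndepFun X P)
    {ι : Type*} [Fintype ι] {B : ι → Set E} (hB : ∀ k, MeasurableSet (B k))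
    (hcard : 2 ≤ Fintype.card ι) {t : ℝ} (ht0 : 0 < t) (ht : t ≤ 1) :
    ∃ R : Ω → ℝ, Measurable R ∧ (∀ ω, 0 ≤ R ω) ∧
      ∫⁻ ω, ENNReal.ofReal (R ω) ∂P ≤ ENNReal.ofReal (Real.log (2 * Fintype.card ι)) ∧
      ∀ ω k, |∑ i, (B k).indicator (fun _ => (1 : ℝ)) (X i ω) - ∑ i, (P.map (X i)).real (B k)| ≤
        t * ∑ i, (P.map (X i)).real (B k) + R ω / t := by
  set K : ℝ := 2 * Fintype.card ι with hK
  have hK4 : 4 ≤ K := by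
    have : (2 : ℝ) ≤ Fintype.card ι := by exact_mod_cast hcard
    rw [hK]; linarith
  -- Needed for `R ≥ 0`; this is where at least two events are used, as `4 > e`.
  have hlog : 1 ≤ Real.log K := by
    rw [Real.le_log_iff_exp_le (by linarith)]
    linarith [Real.exp_one_lt_d9]
  let W : ℝ → ι → Ω → ℝ := fun s k ω =>
    Real.exp (s * (∑ i, (B k).indicator (fun _ => (1 : ℝ)) (X i ω)) -
      (s + s ^ 2) * ∑ i, (P.map (X i)).real (B k))
  let S : Ω → ℝ := fun ω => ∑ k, (W t k ω + W (-t) k ω)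
  have hW0 : ∀ s k ω, 0 < W s k ω := fun s k ω => Real.exp_pos _
  have hWm : ∀ s k, Measurable (W s k) := fun s k => by
    have hm : ∀ i, Measurable fun ω => (B k).indicator (fun _ => (1 : ℝ)) (X i ω) := fun i =>
      (measurable_const.indicator (hB k)).comp (hX i)
    fun_prop
  have hS0 : ∀ ω, 0 ≤ S ω := fun ω =>
    Finset.sum_nonneg fun k _ => (add_pos (hW0 t k ω) (hW0 (-t) k ω)).le
  have hSm : Measurable S := by fun_prop
  -- The logarithm of `S` is replaced by its tangent at `K`. As `S` is a sum of `K` exponentials of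
  -- mean at most `1`, the tangent has mean at most `log K`.
  have hlogle : ∀ ω k, ∀ y, Real.exp y ≤ W t k ω + W (-t) k ω → y ≤ S ω / K + Real.log K - 1 := by
    intro ω k y hy
    have h1 : Real.exp y ≤ S ω := hy.trans
      (Finset.single_le_sum (f := fun k => W t k ω + W (-t) k ω)
        (fun k _ => (add_pos (hW0 t k ω) (hW0 (-t) k ω)).le) (Finset.mem_univ k))
    have h2 := Real.add_one_le_exp (y - Real.log K)
    rw [Real.exp_sub, Real.exp_log (by linarith)] at h2
    have h3 : Real.exp y / K ≤ S ω / K := by gcongr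
    linarith
  refine ⟨fun ω => S ω / K + Real.log K - 1, by fun_prop, fun ω => ?_, ?_, fun ω k => ?_⟩
  · have : 0 ≤ S ω / K := div_nonneg (hS0 ω) (by linarith)
    linarith
  · have hsplit : ∀ ω, ENNReal.ofReal (S ω / K + Real.log K - 1) =
        ENNReal.ofReal K⁻¹ * (∑ k, (ENNReal.ofReal (W t k ω) + ENNReal.ofReal (W (-t) k ω))) +
          ENNReal.ofReal (Real.log K - 1) := by
      intro ω
      rw [add_sub_assoc, ENNReal.ofReal_add (div_nonneg (hS0 ω) (by linarith)) (by linarith),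
        div_eq_inv_mul, ENNReal.ofReal_mul (by positivity), ENNReal.ofReal_sum_of_nonneg
          fun k _ => (add_pos (hW0 t k ω) (hW0 (-t) k ω)).le]
      simp_rw [ENNReal.ofReal_add (hW0 t _ ω).le (hW0 (-t) _ ω).le]
    simp_rw [hsplit]
    rw [lintegral_add_right _ measurable_const, lintegral_const_mul _ (by fun_prop),
      lintegral_finsetSum _ (fun k _ => by fun_prop)]
    simp_rw [lintegral_add_right _ (hWm (-t) _).ennreal_ofReal]
    have hone : ∀ k, ∫⁻ ω, ENNReal.ofReal (W t k ω) ∂P + ∫⁻ ω, ENNReal.ofReal (W (-t) k ω) ∂P ≤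
        2 := by
      intro k
      rw [← one_add_one_eq_two]
      exact add_le_add
        (lintegral_exp_sum_indicator_le hX hindep (hB k) (by rwa [abs_of_pos ht0]))
        (lintegral_exp_sum_indicator_le hX hindep (hB k) (by rwa [abs_neg, abs_of_pos ht0]))
    calc _ ≤ ENNReal.ofReal K⁻¹ * (∑ _k : ι, 2) + ENNReal.ofReal (Real.log K - 1) := by
          simp only [lintegral_const, measure_univ, mul_one]
          gcongr with k
          exact hone k
      _ = ENNReal.ofReal K⁻¹ * ENNReal.ofReal K + ENNReal.ofReal (Real.log K - 1) := by
          congr 2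
          rw [hK, mul_comm, ENNReal.ofReal_mul (by positivity), ENNReal.ofReal_natCast]
          simp
      _ = ENNReal.ofReal (Real.log K) := by
          rw [← ENNReal.ofReal_mul (by positivity), inv_mul_cancel₀ (by positivity),
            ← ENNReal.ofReal_add (by norm_num) (by linarith)]
          congr 1; ring
  · set A := ∑ i, (B k).indicator (fun _ => (1 : ℝ)) (X i ω)
    set V := ∑ i, (P.map (X i)).real (B k)
    have h1 := hlogle ω k (t * A - (t + t ^ 2) * V) (by
      have := (hW0 (-t) k ω).le
      linarith [show Real.exp (t * A - (t + t ^ 2) * V) = W t k ω from rfl])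
    have h2 := hlogle ω k (-t * A - (-t + (-t) ^ 2) * V) (by
      have := (hW0 t k ω).le
      linarith [show Real.exp (-t * A - (-t + (-t) ^ 2) * V) = W (-t) k ω from rfl])
    have h3 : |A - V| * t ≤ t ^ 2 * V + (S ω / K + Real.log K - 1) := by
      rcases abs_cases (A - V) with ⟨h, _⟩ | ⟨h, _⟩ <;> rw [h] <;> nlinarith
    rw [show t * V + (S ω / K + Real.log K - 1) / t =
      (t ^ 2 * V + (S ω / K + Real.log K - 1)) / t by field_simp, le_div_iff₀ ht0]
    exact h3

end Deviations

/-! ### The average law and uniform deviations over boxes -/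

/-- The average of the laws of the observations. -/
noncomputable def meanLaw {Ω E : Type*} [MeasurableSpace Ω] [MeasurableSpace E] (P : Measure Ω)
    {n : ℕ} (X : Fin n → Ω → E) : Measure E :=
  (n : ℝ≥0∞)⁻¹ • ∑ i, P.map (X i)

theorem meanLaw_absolutelyContinuous {Ω E : Type*} [MeasurableSpace Ω] [MeasurableSpace E]
    {P : Measure Ω} {n : ℕ} {X : Fin n → Ω → E} {ν : Measure E} (h : ∀ i, P.map (X i) ≪ ν) :
    meanLaw P X ≪ ν := by
  intro S hS
  rw [meanLaw, Measure.smul_apply, Measure.finsetSum_apply]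
  simp [fun i => h i hS]

section MeanLaw

variable {Ω E : Type*} [MeasurableSpace Ω] [MeasurableSpace E] {P : Measure Ω}
  [IsProbabilityMeasure P] {n : ℕ} {X : Fin n → Ω → E}

theorem isProbabilityMeasure_meanLaw (hn : 1 ≤ n) (hX : ∀ i, Measurable (X i)) :
    IsProbabilityMeasure (meanLaw P X) := by
  have hP : ∀ i, IsProbabilityMeasure (P.map (X i)) := fun i =>
    Measure.isProbabilityMeasure_map (hX i).aemeasurable
  refine ⟨?_⟩
  rw [meanLaw, Measure.smul_apply, Measure.finsetSum_apply]
  simp only [measure_univ, Finset.sum_const, Finset.card_univ, Fintype.card_fin, nsmul_eq_mul,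
    mul_one, smul_eq_mul]
  exact ENNReal.inv_mul_cancel (by simp; omega) (by simp)

theorem meanLaw_real (hX : ∀ i, Measurable (X i)) (S : Set E) :
    (meanLaw P X).real S = 1 / n * ∑ i, (P.map (X i)).real S := by
  have hP : ∀ i, IsProbabilityMeasure (P.map (X i)) := fun i =>
    Measure.isProbabilityMeasure_map (hX i).aemeasurable
  rw [meanLaw, Measure.real, Measure.smul_apply, Measure.finsetSum_apply, smul_eq_mul,
    ENNReal.toReal_mul, ENNReal.toReal_sum fun i _ => measure_ne_top _ _]
  simp [Measure.real]

end MeanLaw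

section Observations

variable {Ω : Type*} [MeasurableSpace Ω] {P : Measure Ω} [IsProbabilityMeasure P] {d n : ℕ}
  {X : Fin n → Ω → Rd d}

/-- Uniform deviations of the empirical measure over boxes. -/
theorem exists_box_deviation_bound (hd : 1 ≤ d) (hn : 1 ≤ n) (hX : ∀ i, Measurable (X i))
    (hindep : iIndepFun X P) (hac : meanLaw P X ≪ volume) {t : ℝ} (ht0 : 0 < t) (ht : t ≤ 1) :
    ∃ R : Ω → ℝ, Measurable R ∧ (∀ ω, 0 ≤ R ω) ∧
      ∫⁻ ω, ENNReal.ofReal (R ω) ∂P ≤ ENNReal.ofReal (Real.log (2 * ((n : ℝ) + 1) ^ (2 * d))) ∧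
      ∀ ω, ∀ S ∈ boxes d,
        |1 / n * ∑ i, S.indicator (fun _ => (1 : ℝ)) (X i ω) - (meanLaw P X).real S| ≤
          t * (meanLaw P X).real S + (4 * d + R ω / t) / n := by
  have hn0 : (0 : ℝ) < n := by exact_mod_cast hn
  have hQ := isProbabilityMeasure_meanLaw (P := P) hn hX
  -- With mesh `1/n` the bracketing error `2d/n` has the order of the remainder. It enters once
  -- through `Q` and once through `t Q`, whence `4d/n`.
  obtain ⟨B, hBm, hB⟩ := exists_box_bracketing hn (meanLaw P X) hac
  have hcard : Fintype.card (Fin d → Fin (n + 1) × Fin (n + 1)) = (n + 1) ^ (2 * d) := by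
    simp only [Fintype.card_fun, Fintype.card_prod, Fintype.card_fin]
    rw [pow_mul, sq]
  obtain ⟨R, hRm, hR0, hRint, hR⟩ := exists_deviation_bound hX hindep hBm (by
    rw [hcard]
    calc 2 ≤ n + 1 := by omega
      _ ≤ (n + 1) ^ (2 * d) := Nat.le_self_pow (by omega) _) ht0 ht
  refine ⟨R, hRm, hR0, ?_, fun ω S hS => ?_⟩
  · rw [hcard] at hRint
    exact_mod_cast hRint
  have hdev : ∀ k, |1 / n * ∑ i, (B k).indicator (fun _ => (1 : ℝ)) (X i ω) -
      (meanLaw P X).real (B k)| ≤ t * (meanLaw P X).real (B k) + R ω / t / n := by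
    intro k
    rw [meanLaw_real hX, ← mul_sub, abs_mul, abs_of_pos (by positivity)]
    calc _ ≤ 1 / n * (t * ∑ i, (P.map (X i)).real (B k) + R ω / t) := by
          gcongr; exact hR ω k
      _ = _ := by ring
  have hmono : ∀ {S T : Set (Rd d)}, S ⊆ T →
      1 / n * ∑ i, S.indicator (fun _ => (1 : ℝ)) (X i ω) ≤
        1 / n * ∑ i, T.indicator (fun _ => (1 : ℝ)) (X i ω) := by
    intro S T hST
    gcongr
  obtain ⟨i, j, hi, hj, hij⟩ := hB S hS
  have hdiff : (meanLaw P X).real (B j) - (meanLaw P X).real (B i) ≤ 2 * d / n := by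
    rw [← measureReal_sdiff (hi.trans hj) (hBm i)]; exact hij
  have hQi : (meanLaw P X).real (B i) ≤ (meanLaw P X).real S := measureReal_mono hi
  have hQj : (meanLaw P X).real S ≤ (meanLaw P X).real (B j) := measureReal_mono hj
  have h1 := hmono hi
  have h2 := hmono hj
  have h3 := abs_le.1 (hdev i)
  have h4 := abs_le.1 (hdev j)
  have e : (4 * d + R ω / t) / n = 2 * d / n + 2 * d / n + R ω / t / n := by ring
  have hd0 : (0 : ℝ) ≤ 2 * d / n := by positivity
  have h5 : t * (2 * d / n) ≤ 2 * d / n := mul_le_of_le_one_left hd0 ht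
  have h6 : t * (meanLaw P X).real (B i) ≤ t * (meanLaw P X).real S := by gcongr
  have h7 : t * (meanLaw P X).real (B j) ≤ t * ((meanLaw P X).real S + 2 * d / n) := by
    gcongr; linarith
  rw [e, abs_le]
  constructor <;> linarith

end Observations

/-! ### The deterministic risk bound -/

theorem abs_setIntegral_le_eLpNorm_top_mul {d : ℕ} {f : Rd d → ℝ} {S : Set (Rd d)}
    (hS : volume S ≠ ∞) (hf : eLpNorm f ∞ volume ≠ ∞) :
    |∫ y in S, f y| ≤ (eLpNorm f ∞ volume).toReal * volume.real S := by
  rw [← Real.norm_eq_abs]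
  refine norm_setIntegral_le_of_norm_le_const_ae hS.lt_top (ae_restrict_of_ae ?_)
  filter_upwards [ae_le_eLpNormEssSup (f := f) (μ := volume)] with y hy
  rw [← eLpNorm_exponent_top] at hy
  rw [← toReal_enorm]
  exact ENNReal.toReal_mono hf hy

theorem tStat_eq {d n : ℕ} (hn : 1 ≤ n) (h : ℝ) (C : (Rd d → ℝ) → (Rd d → ℝ) → Set (Rd d))
    (τ : (Rd d → ℝ) → (Rd d → ℝ) → ℝ) (x : Fin n → Rd d) (p q : Rd d → ℝ) :
    tStat h C τ x p q = τ p q * ((∫ y in C p q, p y) -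
      1 / n * ∑ i, (C p q).indicator (fun _ => (1 : ℝ)) (x i)) / (volume.real (C p q) + h) := by
  have hn0 : (n : ℝ) ≠ 0 := by positivity
  rw [tStat, ← Finset.mul_sum, ← Finset.sum_div, Finset.sum_sub_distrib]
  simp only [Finset.sum_const, Finset.card_univ, Fintype.card_fin, nsmul_eq_mul]
  field_simp

/-- The deterministic bound on the risk, given a uniform bound on the deviations over boxes. -/
theorem eLpNorm_sub_le_of_tSup_le {d n r : ℕ} (hd : 1 ≤ d) (hn : 1 ≤ n) (hr : 1 ≤ r)
    {cells : Set (Set (Rd d))} (hcells : IsBoxPartition cells)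
    {C : (Rd d → ℝ) → Set (Rd d)}
    (hC : ∀ f ∈ piecewisePoly r cells, IsTestSet r cells (hModel r cells) f (C f))
    {τ : (Rd d → ℝ) → (Rd d → ℝ) → ℝ}
    (hτ : ∀ p ∈ piecewisePoly r cells, ∀ q ∈ piecewisePoly r cells,
      IsSignOf (τ p q) (∫ y in C (p - q), (p y - q y)))
    {s : Rd d → ℝ} (hs : Integrable s volume) {x : Fin n → Rd d} {Z δ : ℝ}
    (hZ : ∀ S ∈ boxes d, volume S ≠ ∞ →
      |1 / n * ∑ i, S.indicator (fun _ => (1 : ℝ)) (x i) - ∫ y in S, s y| ≤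
        Z * (volume.real S + hModel r cells))
    {f q : Rd d → ℝ} (hf : f ∈ piecewisePoly r cells) (hq : q ∈ piecewisePoly r cells)
    (hfle : tSup (piecewisePoly r cells) (hModel r cells) (fun q q' => C (q - q')) τ x f ≤
      (⨅ p ∈ piecewisePoly r cells,
        tSup (piecewisePoly r cells) (hModel r cells) (fun q q' => C (q - q')) τ x p) + (δ : EReal)) :
    eLpNorm (f - s) ∞ volume ≤ 5 * eLpNorm (q - s) ∞ volume + ENNReal.ofReal (4 * Z + 2 * δ) := by
  by_cases hfin : eLpNorm (q - s) ∞ volume = ∞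
  · rw [hfin]; simp
  have hh := hModel_pos hr hcells.volume_pos
  set h := hModel r cells
  set e := (eLpNorm (q - s) ∞ volume).toReal with he
  have he0 : 0 ≤ e := ENNReal.toReal_nonneg
  have hCfin : ∀ a ∈ piecewisePoly r cells, ∀ b ∈ piecewisePoly r cells,
      ∀ c ∈ piecewisePoly r cells, volume (C (a - b)) ≠ ∞ ∧ IntegrableOn c (C (a - b)) volume := by
    intro a ha b hb c hc
    have hab := sub_mem_piecewisePoly ha hb
    obtain ⟨-, ⟨I, hI, hCI⟩, -⟩ := (hC _ hab).properties hr hd hcells hab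
    exact ⟨((hcells.bounded I hI).subset hCI).measure_lt_top.ne,
      (integrableOn_of_mem_piecewisePoly hcells hc hI).mono_set hCI⟩
  have hdev : ∀ a ∈ piecewisePoly r cells, ∀ b ∈ piecewisePoly r cells,
      |(∫ y in C (a - b), q y) -
        1 / n * ∑ i, (C (a - b)).indicator (fun _ => (1 : ℝ)) (x i)| ≤
      (e + Z) * (volume.real (C (a - b)) + h) := by
    intro a ha b hb
    have hab := sub_mem_piecewisePoly ha hb
    obtain ⟨hbox, -, -⟩ := (hC _ hab).properties hr hd hcells hab
    obtain ⟨hfinC, hqC⟩ := hCfin a ha b hb q hq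
    have h1 := abs_setIntegral_le_eLpNorm_top_mul hfinC hfin
    have h2 := hZ _ hbox hfinC
    simp only [Pi.sub_apply] at h1
    rw [integral_sub hqC hs.integrableOn, ← he] at h1
    have h3 : e * volume.real (C (a - b)) ≤ e * (volume.real (C (a - b)) + h) := by
      gcongr; linarith
    rw [add_mul]
    rw [abs_le] at *
    constructor <;> linarith
  have hpos : ∀ S : Set (Rd d), 0 < volume.real S + h := fun S => by
    have : 0 ≤ volume.real S := measureReal_nonneg
    linarith
  have hτabs : ∀ a ∈ piecewisePoly r cells, ∀ b ∈ piecewisePoly r cells, |τ a b| = 1 := by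
    intro a ha b hb
    rcases (hτ a ha b hb).1 with h | h <;> simp [h]
  have hupper : ∀ q' ∈ piecewisePoly r cells,
      tStat h (fun q q' => C (q - q')) τ x q q' ≤ e + Z := by
    intro q' hq'
    rw [tStat_eq hn, div_le_iff₀ (hpos _)]
    refine (le_abs_self _).trans ?_
    rw [abs_mul, hτabs q hq q' hq', one_mul]
    exact hdev q hq q' hq'
  -- Write `∫ f` as `∫ (f - q) + ∫ q`: the sign `τ f q` turns the first integral into its absolute
  -- value, and the second differs from the empirical frequency by the deviation already bounded.
  have hlower : |∫ y in C (f - q), (f y - q y)| / (volume.real (C (f - q)) + h) - (e + Z) ≤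
      tStat h (fun q q' => C (q - q')) τ x f q := by
    rw [tStat_eq hn, le_div_iff₀ (hpos _), sub_mul, div_mul_cancel₀ _ (hpos _).ne',
      ← (hτ f hf q hq).2, integral_sub (hCfin f hf q hq f hf).2 (hCfin f hf q hq q hq).2]
    have h1 := hdev f hf q hq
    have h2 : |τ f q * ((∫ y in C (f - q), q y) -
        1 / n * ∑ i, (C (f - q)).indicator (fun _ => (1 : ℝ)) (x i))| ≤
        (e + Z) * (volume.real (C (f - q)) + h) := by
      rwa [abs_mul, hτabs f hf q hq, one_mul]
    have h3 := (abs_le.1 h2).1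
    linarith
  have hchain : tStat h (fun q q' => C (q - q')) τ x f q ≤ e + Z + δ := by
    rw [← EReal.coe_le_coe_iff]
    calc _ ≤ tSup (piecewisePoly r cells) h (fun q q' => C (q - q')) τ x f :=
          le_iSup₂_of_le q hq le_rfl
      _ ≤ _ := hfle
      _ ≤ ((e + Z : ℝ) : EReal) + δ := by
          gcongr
          refine iInf₂_le_of_le q hq (iSup₂_le fun q' hq' => ?_)
          exact EReal.coe_le_coe_iff.2 (hupper q' hq')
      _ = _ := by push_cast; rfl
  have hfq := sub_mem_piecewisePoly hf hq
  obtain ⟨-, -, hnorm⟩ := (hC _ hfq).properties hr hd hcells hfq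
  have hadd : eLpNorm (f - s) ∞ volume ≤
      eLpNorm (f - q) ∞ volume + eLpNorm (q - s) ∞ volume := by
    rw [← sub_add_sub_cancel f q s]
    simp only [eLpNorm_exponent_top]
    exact eLpNormEssSup_add_le
  have hZ0 : 0 ≤ 2 * e + 2 * Z + δ := by
    have : 0 ≤ |∫ y in C (f - q), (f y - q y)| / (volume.real (C (f - q)) + h) :=
      div_nonneg (abs_nonneg _) (hpos _).le
    linarith
  calc _ ≤ _ := hadd
    _ ≤ ENNReal.ofReal (4 * e + (4 * Z + 2 * δ)) + eLpNorm (q - s) ∞ volume := by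
        gcongr
        refine hnorm.trans (ENNReal.ofReal_le_ofReal ?_)
        simp only [Pi.sub_apply]
        rw [mul_div_assoc]
        linarith
    _ ≤ (ENNReal.ofReal (4 * e) + ENNReal.ofReal (4 * Z + 2 * δ)) + eLpNorm (q - s) ∞ volume := by
        gcongr
        exact ENNReal.ofReal_add_le
    _ = _ := by
        rw [ENNReal.ofReal_mul (by norm_num), he, ENNReal.ofReal_toReal hfin, ENNReal.ofReal_ofNat]
        ring

/-! ### The mean density -/

section MeanDensity

variable {Ω : Type*} [MeasurableSpace Ω] {P : Measure Ω} [IsProbabilityMeasure P] {d n : ℕ}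
  {X : Fin n → Ω → Rd d} {p : Fin n → Rd d → ℝ}

theorem integrable_of_map_eq_withDensity {Y : Ω → Rd d} (hY : Measurable Y) {f : Rd d → ℝ}
    (hf0 : 0 ≤ᵐ[volume] f) (hf : AEStronglyMeasurable f volume)
    (hYf : P.map Y = volume.withDensity fun x => ENNReal.ofReal (f x)) : Integrable f volume := by
  refine ⟨hf, ?_⟩
  rw [hasFiniteIntegral_iff_ofReal hf0]
  have h := congrArg (fun ν => ν Set.univ) hYf
  simp only [Measure.map_apply hY MeasurableSet.univ, Set.preimage_univ, measure_univ,
    withDensity_apply _ MeasurableSet.univ, Measure.restrict_univ] at h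
  rw [← h]
  exact ENNReal.one_lt_top

theorem integrable_meanDensity (hX : ∀ i, Measurable (X i)) (hp0 : ∀ i, 0 ≤ᵐ[volume] p i)
    (hp : ∀ i, MemLp (p i) ∞ volume)
    (hXp : ∀ i, P.map (X i) = volume.withDensity fun x => ENNReal.ofReal (p i x)) :
    Integrable (meanDensity p) volume :=
  (integrable_finsetSum _ fun i _ =>
    integrable_of_map_eq_withDensity (hX i) (hp0 i) (hp i).1 (hXp i)).const_mul _

theorem meanLaw_real_eq_setIntegral (hX : ∀ i, Measurable (X i)) (hp0 : ∀ i, 0 ≤ᵐ[volume] p i)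
    (hp : ∀ i, MemLp (p i) ∞ volume)
    (hXp : ∀ i, P.map (X i) = volume.withDensity fun x => ENNReal.ofReal (p i x))
    {S : Set (Rd d)} (hS : MeasurableSet S) :
    (meanLaw P X).real S = ∫ y in S, meanDensity p y := by
  have hint := fun i => integrable_of_map_eq_withDensity (hX i) (hp0 i) (hp i).1 (hXp i)
  simp only [meanDensity]
  rw [meanLaw_real hX, integral_const_mul, integral_finsetSum _ fun i _ => (hint i).integrableOn]
  congr 1
  refine Finset.sum_congr rfl fun i _ => ?_
  rw [hXp i, Measure.real, withDensity_apply _ hS,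
    integral_eq_lintegral_of_nonneg_ae (ae_restrict_of_ae (hp0 i)) (hp i).1.restrict]

theorem memLp_meanDensity (hp : ∀ i, MemLp (p i) ∞ volume) : MemLp (meanDensity p) ∞ volume :=
  (memLp_finsetSum _ fun i _ => hp i).const_mul _

end MeanDensity

/-! ### Optimisation of the parameter and numerical constants -/

/-- The minimiser `√(u/A)` is admissible when `u ≤ A`; otherwise `t = 1` costs `A + u ≤ 2u`. -/
theorem exists_mul_add_div_le {A u : ℝ} (hA : 0 ≤ A) (hu : 0 < u) :
    ∃ t, 0 < t ∧ t ≤ 1 ∧ t * A + u / t ≤ 2 * Real.sqrt (A * u) + 2 * u := by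
  rcases le_total A u with h | h
  · exact ⟨1, one_pos, le_rfl, by have := Real.sqrt_nonneg (A * u); linarith⟩
  · have hA0 : 0 < A := hu.trans_le h
    have h1 : 0 < Real.sqrt u := Real.sqrt_pos.2 hu
    have h2 : 0 < Real.sqrt A := Real.sqrt_pos.2 hA0
    refine ⟨Real.sqrt u / Real.sqrt A, by positivity, ?_, ?_⟩
    · rw [div_le_one h2]; exact Real.sqrt_le_sqrt h
    · have e1 : Real.sqrt u / Real.sqrt A * A = Real.sqrt A * Real.sqrt u := by
        nth_rewrite 2 [← Real.mul_self_sqrt hA]; field_simp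
      have e2 : u / (Real.sqrt u / Real.sqrt A) = Real.sqrt A * Real.sqrt u := by
        nth_rewrite 1 [← Real.mul_self_sqrt hu.le]; field_simp
      rw [e1, e2, Real.sqrt_mul hA]
      linarith

theorem log_two_mul_pow_le {n : ℕ} (hn : 1 ≤ n) (d : ℕ) :
    Real.log (2 * ((n : ℝ) + 1) ^ (2 * d)) ≤ (2 * d + 1) * Real.log (Real.exp 1 * n) := by
  have hn1 : (1 : ℝ) ≤ n := by exact_mod_cast hn
  have hlog0 := Real.log_nonneg hn1
  have hlog2 : Real.log 2 ≤ 1 := by linarith [Real.log_two_lt_d9]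
  have h1 : Real.log ((n : ℝ) + 1) ≤ 1 + Real.log n := by
    calc _ ≤ Real.log (2 * n) := Real.log_le_log (by positivity) (by linarith)
      _ = Real.log 2 + Real.log n := Real.log_mul (by norm_num) (by positivity)
      _ ≤ _ := by linarith
  rw [Real.log_mul (by norm_num) (by positivity), Real.log_pow,
    Real.log_mul (Real.exp_pos 1).ne' (by positivity), Real.log_exp]
  push_cast
  have h2 : 2 * (d : ℝ) * Real.log ((n : ℝ) + 1) ≤ 2 * d * (1 + Real.log n) := by gcongr
  linarith

/-- From `1 - 1/√2 ≥ 1/4` follows `2r² ≤ (1 - 1/√2) (3r)²`, used once per dimension; the extra power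
gives the factor `4`. -/
theorem inv_hModel_le {d r : ℕ} (hr : 1 ≤ r) {cells : Set (Set (Rd d))}
    (h0 : 0 < minCellVolume cells) :
    (hModel r cells)⁻¹ ≤ 4 * (3 * (r : ℝ)) ^ (2 * d) / minCellVolume cells := by
  have hr' : (0 : ℝ) < r := by exact_mod_cast hr
  have hκ : 1 / 4 ≤ 1 - 1 / Real.sqrt 2 := by
    rw [one_div_sqrt_two]; linarith [sqrt_two_bounds.2]
  have hκ0 : 0 < 1 - 1 / Real.sqrt 2 := by linarith
  have h1 : (2 * (r : ℝ) ^ 2) ^ d ≤ (1 - 1 / Real.sqrt 2) ^ d * (3 * (r : ℝ)) ^ (2 * d) := by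
    rw [pow_mul, ← mul_pow]
    refine pow_le_pow_left₀ (by positivity) ?_ d
    nlinarith [sq_nonneg (r : ℝ)]
  have h2 : (2 * (r : ℝ) ^ 2) ^ d ≤
      (1 - 1 / Real.sqrt 2) ^ (d + 1) * (4 * (3 * (r : ℝ)) ^ (2 * d)) := by
    have : 0 ≤ (1 - 1 / Real.sqrt 2) ^ d * (3 * (r : ℝ)) ^ (2 * d) := by positivity
    calc _ ≤ _ := h1
      _ ≤ (4 * (1 - 1 / Real.sqrt 2)) *
          ((1 - 1 / Real.sqrt 2) ^ d * (3 * (r : ℝ)) ^ (2 * d)) :=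
        le_mul_of_one_le_left this (by linarith)
      _ = _ := by ring
  rw [hModel, mul_inv, inv_div, ← div_eq_mul_inv]
  gcongr
  rw [div_le_iff₀ (by positivity)]
  linarith

/-- Comparison of the bound in terms of `h` with the bound in terms of `h₀`. -/
theorem risk_bound_le {d n r : ℕ} (hn : 1 ≤ n) {h h₀ l S : ℝ} (hh : 0 < h) (hh₀ : 0 < h₀)
    (hinv : h⁻¹ ≤ 4 * (3 * (r : ℝ)) ^ (2 * d) / h₀) (hl0 : 0 ≤ l)
    (hl : l ≤ (2 * d + 1) * Real.log (Real.exp 1 * n)) (hS : 0 ≤ S) :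
    8 * Real.sqrt (min S h⁻¹ * (l / (n * h))) + 8 * (l / (n * h)) + 16 * d / (n * h) ≤
      274 * (2 * (d : ℝ) + 1) * (3 * (r : ℝ)) ^ (2 * d) *
          (Real.log (Real.exp 1 * n) / (h₀ * n)) +
        215 * Real.sqrt (2 * (d : ℝ) + 1) *
          min ((3 * (r : ℝ)) ^ d * Real.sqrt S * Real.sqrt (Real.log (Real.exp 1 * n) / (h₀ * n)))
            ((3 * (r : ℝ)) ^ (2 * d) * (Real.sqrt (Real.log (Real.exp 1 * n)) /
              (h₀ * Real.sqrt n))) := by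
  have hn1 : (1 : ℝ) ≤ n := by exact_mod_cast hn
  have hn0 : (0 : ℝ) < n := by linarith
  set L := Real.log (Real.exp 1 * n) with hL
  have hL1 : 1 ≤ L := by
    rw [hL, Real.log_mul (Real.exp_pos 1).ne' hn0.ne', Real.log_exp]
    linarith [Real.log_nonneg hn1]
  set D : ℝ := 2 * d + 1 with hD
  have hD1 : 1 ≤ D := by rw [hD]; linarith [Nat.cast_nonneg (α := ℝ) d]
  set ρ : ℝ := (3 * (r : ℝ)) ^ d with hρ
  have hρ0 : 0 ≤ ρ := by positivity
  have hρ2 : (3 * (r : ℝ)) ^ (2 * d) = ρ ^ 2 := by rw [hρ, ← pow_mul, mul_comm 2 d]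
  rw [hρ2] at hinv ⊢
  have hu : l / (n * h) ≤ D * L * h⁻¹ / n := by
    rw [div_eq_mul_inv, mul_inv, mul_comm (n : ℝ)⁻¹, ← mul_assoc, ← div_eq_mul_inv]
    gcongr
  have hu' : D * L * h⁻¹ / n ≤ 4 * (D * ρ ^ 2 * (L / (h₀ * n))) := by
    calc _ ≤ D * L * (4 * ρ ^ 2 / h₀) / n := by gcongr
      _ = _ := by field_simp
  have hd : 16 * d / (n * h) ≤ 8 * (D * L * h⁻¹ / n) := by
    have : 16 * (d : ℝ) ≤ 8 * (D * L) := by nlinarith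
    calc _ = 16 * d * h⁻¹ / n := by field_simp
      _ ≤ 8 * (D * L) * h⁻¹ / n := by gcongr
      _ = _ := by ring
  -- The estimates give `64` here, and `16` and `32` for the two square-root bounds below, well
  -- within `274` and `215`.
  have hlin : 8 * (l / (n * h)) + 16 * d / (n * h) ≤ 274 * D * ρ ^ 2 * (L / (h₀ * n)) := by
    have : 0 ≤ D * ρ ^ 2 * (L / (h₀ * n)) := by positivity
    linarith
  have hsq : 8 * Real.sqrt (min S h⁻¹ * (l / (n * h))) ≤ 215 * Real.sqrt D *
      min (ρ * Real.sqrt S * Real.sqrt (L / (h₀ * n)))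
        (ρ ^ 2 * (Real.sqrt L / (h₀ * Real.sqrt n))) := by
    have hu0 : 0 ≤ l / (n * h) := by positivity
    rw [mul_min_of_nonneg _ _ (by positivity)]
    refine le_min ?_ ?_
    · have h1 : Real.sqrt (min S h⁻¹ * (l / (n * h))) ≤
          2 * (Real.sqrt D * (ρ * Real.sqrt S * Real.sqrt (L / (h₀ * n)))) := by
        refine Real.sqrt_le_iff.2 ⟨by positivity, ?_⟩
        simp only [mul_pow, Real.sq_sqrt hS, Real.sq_sqrt (by positivity : 0 ≤ D),
          Real.sq_sqrt (by positivity : 0 ≤ L / (h₀ * n))]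
        calc _ ≤ S * (4 * (D * ρ ^ 2 * (L / (h₀ * n)))) := by
              gcongr
              · exact min_le_left _ _
              · exact hu.trans hu'
          _ = _ := by ring
      have h2 : 0 ≤ Real.sqrt D * (ρ * Real.sqrt S * Real.sqrt (L / (h₀ * n))) := by positivity
      linarith
    · have h1 : Real.sqrt (min S h⁻¹ * (l / (n * h))) ≤
          4 * (Real.sqrt D * (ρ ^ 2 * (Real.sqrt L / (h₀ * Real.sqrt n)))) := by
        refine Real.sqrt_le_iff.2 ⟨by positivity, ?_⟩
        have hhi : 0 ≤ h⁻¹ := (inv_pos.2 hh).le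
        simp only [mul_pow, div_pow, Real.sq_sqrt (by positivity : 0 ≤ D),
          Real.sq_sqrt (by positivity : 0 ≤ L), Real.sq_sqrt hn0.le]
        calc _ ≤ h⁻¹ * (D * L * h⁻¹ / n) := by
              gcongr
              exact min_le_right _ _
          _ ≤ (4 * ρ ^ 2 / h₀) * (D * L * (4 * ρ ^ 2 / h₀) / n) := by gcongr
          _ = _ := by field_simp
      have h2 : 0 ≤ Real.sqrt D * (ρ ^ 2 * (Real.sqrt L / (h₀ * Real.sqrt n))) := by positivity
      linarith
  linarith

/-! ### The risk bound -/

theorem mainTheorem9 {Ω : Type*} [MeasurableSpace Ω] (P : Measure Ω) [IsProbabilityMeasure P]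
    (d n r : ℕ) (hd : 1 ≤ d) (hn : 1 ≤ n) (hr : 1 ≤ r)
    (cells : Set (Set (Rd d))) (hcells : IsBoxPartition cells)
    -- independent observations with essentially bounded densities
    (X : Fin n → Ω → Rd d) (hX : ∀ i, Measurable (X i)) (hindep : iIndepFun X P)
    (p : Fin n → Rd d → ℝ) (hp_nonneg : ∀ i, 0 ≤ᵐ[volume] p i)
    (hp_bdd : ∀ i, MemLp (p i) ∞ volume)
    (hp_density : ∀ i, P.map (X i) = volume.withDensity (fun x => ENNReal.ofReal (p i x)))
    -- any admissible choice of the test sets and of the signs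
    (C : (Rd d → ℝ) → Set (Rd d))
    (hC : ∀ f ∈ piecewisePoly r cells, IsTestSet r cells (hModel r cells) f (C f))
    (τ : (Rd d → ℝ) → (Rd d → ℝ) → ℝ)
    (δ : ℝ) (hδ : 0 < δ) (phat : Ω → Rd d → ℝ)
    (hphat : IsHunEstimator P X (piecewisePoly r cells) (hModel r cells)
      (fun q q' => C (q - q')) τ δ phat) :
    ∫⁻ ω, eLpNorm (phat ω - meanDensity p) ∞ volume ∂P ≤
      5 * (⨅ q ∈ piecewisePoly r cells, eLpNorm (q - meanDensity p) ∞ volume) +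
      ENNReal.ofReal
        (274 * (2 * (d : ℝ) + 1) * (3 * (r : ℝ)) ^ (2 * d) *
            (Real.log (Real.exp 1 * n) / (minCellVolume cells * n)) +
          2 * δ +
          215 * Real.sqrt (2 * (d : ℝ) + 1) *
            min ((3 * (r : ℝ)) ^ d * Real.sqrt ((eLpNorm (meanDensity p) ∞ volume).toReal) *
                  Real.sqrt (Real.log (Real.exp 1 * n) / (minCellVolume cells * n)))
                ((3 * (r : ℝ)) ^ (2 * d) * (Real.sqrt (Real.log (Real.exp 1 * n)) /
                  (minCellVolume cells * Real.sqrt n)))) := by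
  have hn0 : (0 : ℝ) < n := by exact_mod_cast hn
  have hh := hModel_pos hr hcells.volume_pos
  have hQ := isProbabilityMeasure_meanLaw (P := P) hn hX
  have hac : meanLaw P X ≪ volume := meanLaw_absolutelyContinuous fun i => by
    rw [hp_density i]; exact withDensity_absolutelyContinuous _ _
  have hint := integrable_meanDensity hX hp_nonneg hp_bdd hp_density
  set S := (eLpNorm (meanDensity p) ∞ volume).toReal with hS
  have hS0 : 0 ≤ S := ENNReal.toReal_nonneg
  set h := hModel r cells with hh_def
  set l := Real.log (2 * ((n : ℝ) + 1) ^ (2 * d)) with hl_def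
  have hl0 : 0 < l := by
    refine Real.log_pos ?_
    have : (1 : ℝ) ≤ ((n : ℝ) + 1) ^ (2 * d) := one_le_pow₀ (by linarith)
    linarith
  set A := min S h⁻¹ with hA
  have hA0 : 0 ≤ A := le_min hS0 (inv_pos.2 hh).le
  -- Since `R` depends on `t`, the parameter must be deterministic; it is tuned to the bound `l` on
  -- the mean of `R`.
  obtain ⟨t, ht0, ht1, htA⟩ := exists_mul_add_div_le hA0 (by positivity : 0 < l / (n * h))
  obtain ⟨R, hRm, hR0, hRint, hR⟩ := exists_box_deviation_bound hd hn hX hindep hac ht0 ht1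
  -- The two bounds, by the density and by total mass `1`, lead to the two terms of the minimum in
  -- the conclusion.
  have hmass : ∀ B ∈ boxes d, volume B ≠ ∞ →
      (meanLaw P X).real B ≤ A * (volume.real B + h) := by
    intro B hB hfin
    have hv : 0 ≤ volume.real B := measureReal_nonneg
    have h1 : (meanLaw P X).real B ≤ S * (volume.real B + h) := by
      rw [meanLaw_real_eq_setIntegral hX hp_nonneg hp_bdd hp_density
        (measurableSet_of_mem_boxes hB)]
      refine (le_abs_self _).trans ((abs_setIntegral_le_eLpNorm_top_mul hfin
        (memLp_meanDensity hp_bdd).2.ne).trans ?_)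
      gcongr
      linarith
    have h2 : (meanLaw P X).real B ≤ h⁻¹ * (volume.real B + h) := by
      refine measureReal_le_one.trans ?_
      rw [inv_mul_eq_div, le_div_iff₀ hh]
      linarith
    rw [hA, min_mul_of_nonneg _ _ (by linarith)]
    exact le_min h1 h2
  set Z : Ω → ℝ := fun ω => t * A + (4 * d + R ω / t) / (n * h) with hZ_def
  have hdev : ∀ ω, ∀ B ∈ boxes d, volume B ≠ ∞ →
      |1 / n * ∑ i, B.indicator (fun _ => (1 : ℝ)) (X i ω) - ∫ y in B, meanDensity p y| ≤
        Z ω * (volume.real B + h) := by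
    intro ω B hB hfin
    rw [← meanLaw_real_eq_setIntegral hX hp_nonneg hp_bdd hp_density
      (measurableSet_of_mem_boxes hB)]
    refine (hR ω B hB).trans ?_
    have hv : 0 ≤ volume.real B := measureReal_nonneg
    have hRt : 0 ≤ R ω / t := div_nonneg (hR0 ω) ht0.le
    have h1 := mul_le_mul_of_nonneg_left (hmass B hB hfin) ht0.le
    have h2 : (4 * d + R ω / t) / n ≤ (4 * d + R ω / t) / (n * h) * (volume.real B + h) := by
      calc _ = (4 * d + R ω / t) / (n * h) * h := by field_simp
        _ ≤ _ := by gcongr; linarith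
    calc _ ≤ _ := add_le_add h1 h2
      _ = _ := by rw [hZ_def]; ring
  set c := 4 * (t * A) + 16 * d / (n * h) + 2 * δ with hc_def
  have hc0 : 0 ≤ c := by positivity
  have hb0 : 0 ≤ 4 / (t * (n * h)) := by positivity
  have hlint : ∫⁻ ω, ENNReal.ofReal (4 * Z ω + 2 * δ) ∂P ≤
      ENNReal.ofReal (c + 4 / (t * (n * h)) * l) := by
    have hsplit : ∀ ω, ENNReal.ofReal (4 * Z ω + 2 * δ) =
        ENNReal.ofReal c + ENNReal.ofReal (4 / (t * (n * h))) * ENNReal.ofReal (R ω) := by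
      intro ω
      rw [← ENNReal.ofReal_mul hb0, ← ENNReal.ofReal_add hc0 (mul_nonneg hb0 (hR0 ω))]
      congr 1
      rw [hZ_def, hc_def]
      field_simp
      ring
    simp_rw [hsplit]
    rw [lintegral_add_left measurable_const, lintegral_const_mul _ hRm.ennreal_ofReal,
      lintegral_const, measure_univ, mul_one, ENNReal.ofReal_add hc0 (mul_nonneg hb0 hl0.le),
      ENNReal.ofReal_mul hb0]
    gcongr
  have hfinal := risk_bound_le (d := d) (r := r) (S := S) hn hh hcells.volume_pos
    (inv_hModel_le hr hcells.volume_pos) hl0.le (log_two_mul_pow_le hn d) hS0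
  have hreal : c + 4 / (t * (n * h)) * l ≤ 8 * Real.sqrt (A * (l / (n * h))) +
      8 * (l / (n * h)) + 16 * d / (n * h) + 2 * δ := by
    have e : 4 / (t * (n * h)) * l = 4 * (l / (n * h) / t) := by field_simp
    rw [e, hc_def]
    linarith
  rw [iInf_subtype', ENNReal.mul_iInf_of_ne (by norm_num) (by norm_num), ENNReal.iInf_add]
  refine le_iInf fun q => ?_
  calc _ ≤ ∫⁻ ω, (5 * eLpNorm ((q : Rd d → ℝ) - meanDensity p) ∞ volume +
        ENNReal.ofReal (4 * Z ω + 2 * δ)) ∂P := by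
        refine lintegral_mono_ae ?_
        filter_upwards [hphat.le] with ω hω
        exact eLpNorm_sub_le_of_tSup_le hd hn hr hcells hC hphat.sign hint (hdev ω)
          (hphat.mem ω) q.2 hω
    _ = 5 * eLpNorm ((q : Rd d → ℝ) - meanDensity p) ∞ volume +
        ∫⁻ ω, ENNReal.ofReal (4 * Z ω + 2 * δ) ∂P := by
        rw [lintegral_add_left measurable_const, lintegral_const, measure_univ, mul_one]
    _ ≤ _ := by
        gcongr
        refine hlint.trans (ENNReal.ofReal_le_ofReal (hreal.trans ?_))
        linarith
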